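/- Let $(M_1,g_{M_1})$, $(M_2,g_{M_2})$, $(N_1,g_{N_1})$, $(N_2,g_{N_2})$ be finite-dimensional smooth Riemannian manifolds (without boundary), with $M_1,M_2$ non-empty, and let $f:M_1\to(0,\infty)$, $\rho:N_1\to(0,\infty)$ be smooth. Write $M=M_1\times_f M_2$ for $M_1\times M_2$ with the warped product metric $g_M=g_{M_1}+f^2g_{M_2}$, and $N=N_1\times_\rho N_2$ with $g_N=g_{N_1}+\rho^2g_{N_2}$. A smooth map $\phi:(M,g_M)\to(N,g_N)$ is a *Riemannian map* if at every $p$ it has positive rank and $\phi_{*p}$ is isometric on the horizontal space $(\ker\phi_{*p})^\perp$. For vertical vectors $u,v\in\ker\phi_{*p}$ let $T_uv=\mathcal H(\nabla_uV)$, where $V$ is any vertical vector field extending $v$, $\nabla$ is the Levi-Civita connection and $\mathcal H$ is the projection onto the horizontal space. The mean curvature vector field of $\phi$ is $H=\frac1k\sum_{i=1}^kT_{e_i}e_i$ for orthonormal bases $(e_i)$ of $\ker\phi_{*p}$. The fibres are totally umbilical if $T_uv=g_M(u,v)H$ and totally geodesic if $T_uv=0$, for all vertical $u,v$. The map $\phi$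 is a *Clairaut Riemannian map* with $r:M\to(0,\infty)$ if it is a Riemannian map and, along every nonconstant geodesic of $M$, $r\sin\theta$ is constant, where $\theta\in[0,\pi/2]$ is the angle between the velocity of the geodesic and the horizontal space. **Theorem.** Let $\phi=\phi_1\times\phi_2:M=M_1\times_fM_2\to N=N_1\times_\rho N_2$ be a Riemannian warped product map, i.e. $\phi_1:M_1\to N_1$ and $\phi_2:M_2\to N_2$ are Riemannian maps and $\phi$ is a Riemannian map for the warped product metrics. Assume that $\ker\phi_{1*p_1}\neq0$ and $\ker\phi_{2*p_2}\neq0$ for all $p_1\in M_1$, $p_2\in M_2$. Consider the three conditions: (i) $\phi_1$ has totally umbilical fibres; (ii) $\phi_2$ has totally geodesic fibres; (iii) the mean curvature vector field of $\phi$ is $-\nabla^M\ln f$. Then $\phi$ is a Clairaut Riemannian map with $r=e^g$ for some smooth function $g$ on $M$ if and only if (i), (ii) and (iii) hold. Moreover, for any given smooth function $g$ on $M$, $\phi$ is Clairaut with $r=e^g$ if and only if (i), (ii) and (iii) hold and $\nabla^Mg=\nabla^M\ln f$. -/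

import Mathlib

open Set Module
open scoped Manifold ContDiff

noncomputable section

namespace ClairautWarped

/-- Smooth Riemannian metrics on a manifold `M` (Mathlib's notion, for the tangent bundle). -/
abbrev RiemMetric {E : Type*} [NormedAddCommGroup E] [NormedSpace ℝ E]
    {H : Type*} [TopologicalSpace H] (I : ModelWithCorners ℝ E H)
    (M : Type*) [TopologicalSpace M] [ChartedSpace H M] [IsManifold I ∞ M] : Type _ :=
  Bundle.ContMDiffRiemannianMetric I ∞ E (fun p : M => TangentSpace I p)

/-- A field of bilinear forms on the tangent spaces of `M`. All notions below are formulas in such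
a field; they are applied to the form of a Riemannian metric or of a warped product metric. -/
abbrev FormField {E : Type*} [NormedAddCommGroup E] [NormedSpace ℝ E]
    {H : Type*} [TopologicalSpace H] (I : ModelWithCorners ℝ E H)
    (M : Type*) [TopologicalSpace M] [ChartedSpace H M] : Type _ :=
  ∀ p : M, LinearMap.BilinForm ℝ (TangentSpace I p)

/-- The field of bilinear forms of a Riemannian metric. -/
def RiemMetric.form {E : Type*} [NormedAddCommGroup E] [NormedSpace ℝ E]
    {H : Type*} [TopologicalSpace H] {I : ModelWithCorners ℝ E H}
    {M : Type*} [TopologicalSpace M] [ChartedSpace H M] [IsManifold I ∞ M]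
    (g : RiemMetric I M) : FormField I M :=
  fun p => LinearMap.mk₂ ℝ (fun u v => g.inner p u v)
    (by intros; simp) (by intros; simp) (by intros; simp) (by intros; simp)

section OneManifold

variable {E : Type*} [NormedAddCommGroup E] [NormedSpace ℝ E]
  {H : Type*} [TopologicalSpace H] {I : ModelWithCorners ℝ E H}
  {M : Type*} [TopologicalSpace M] [ChartedSpace H M]

/-! ### The Levi-Civita connection and geodesics in charts

The preferred chart at `x₀ : M` is `ψ = extChartAt I x₀ : M → E`. -/

/-- The components `g_y(u, v)` of the metric in the chart at `x₀`, at the point `y` of the chart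
domain in `E`, for coordinate vectors `u v : E`. -/
def chartMetric (g : FormField I M) (x₀ : M) (y u v : E) : ℝ :=
  g ((extChartAt I x₀).symm y)
    (mfderiv 𝓘(ℝ, E) I (extChartAt I x₀).symm y u)
    (mfderiv 𝓘(ℝ, E) I (extChartAt I x₀).symm y v)

/-- Christoffel symbols of the first kind:
`½ (∂_u g(v, w) + ∂_v g(u, w) - ∂_w g(u, v))` for coordinate vectors `u v w`. -/
def christoffelFirst (g : FormField I M) (x₀ : M) (y u v w : E) : ℝ :=
  (fderiv ℝ (fun z => chartMetric g x₀ z v w) y u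
    + fderiv ℝ (fun z => chartMetric g x₀ z u w) y v
    - fderiv ℝ (fun z => chartMetric g x₀ z u v) y w) / 2

/-- Christoffel symbols of the second kind: `Γ_y(u, v)` is the vector `a : E` with
`g_y(a, w) = christoffelFirst u v w` for all `w` (it exists and is unique if `g` is a metric). -/
def christoffel (g : FormField I M) (x₀ : M) (y u v : E) : E :=
  Function.invFun (fun (a w : E) => chartMetric g x₀ y a w)
    (fun w => christoffelFirst g x₀ y u v w)

/-- The representation in the chart at `x₀` of a vector field `V` on `M`. -/
def chartField (V : ∀ p : M, TangentSpace I p) (x₀ : M) (y : E) : E :=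
  mfderiv I 𝓘(ℝ, E) (extChartAt I x₀) ((extChartAt I x₀).symm y) (V ((extChartAt I x₀).symm y))

/-- The Levi-Civita covariant derivative `(∇_u V)(p)`, for a tangent vector `u` at `p` and a vector
field `V`, computed in the chart at `p` as `D V (u) + Γ(u, V)`. -/
def leviCivita (g : FormField I M) (V : ∀ p : M, TangentSpace I p) (p : M)
    (u : TangentSpace I p) : TangentSpace I p :=
  let y : E := extChartAt I p p
  let u' : E := mfderiv I 𝓘(ℝ, E) (extChartAt I p) p u
  let a : E := fderiv ℝ (chartField V p) y u' + christoffel g p y u' (chartField V p y)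
  show E from mfderiv 𝓘(ℝ, E) I (extChartAt I p).symm y a

/-- The velocity vector of a curve. -/
def velocity (I : ModelWithCorners ℝ E H) (γ : ℝ → M) (t : ℝ) : TangentSpace I (γ t) :=
  mfderiv 𝓘(ℝ, ℝ) I γ t (1 : ℝ)

/-- `γ` is a geodesic on the open set `J` of parameters: in every chart it satisfies
`x'' + Γ(x', x') = 0`. (A `C²` solution for a smooth metric is automatically smooth.) -/
def IsGeodesicOn (g : FormField I M) (γ : ℝ → M) (J : Set ℝ) : Prop :=
  ContMDiffOn 𝓘(ℝ, ℝ) I 2 γ J ∧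
    ∀ t ∈ J, ∀ x₀ : M, γ t ∈ (extChartAt I x₀).source →
      let x : ℝ → E := fun s => extChartAt I x₀ (γ s)
      deriv (deriv x) t + christoffel g x₀ (x t) (deriv x t) (deriv x t) = 0

/-- The gradient `∇h` at `p`: the vector `a` with `g(a, w) = dh(w)` for all `w`. -/
def gradient (g : FormField I M) (h : M → ℝ) (p : M) : TangentSpace I p :=
  Function.invFun (fun (a w : TangentSpace I p) => g p a w)
    (fun w => (mfderiv I 𝓘(ℝ, ℝ) h p w : ℝ))

end OneManifold

section Maps

variable {E : Type*} [NormedAddCommGroup E] [NormedSpace ℝ E]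
  {H : Type*} [TopologicalSpace H] {I : ModelWithCorners ℝ E H}
  {M : Type*} [TopologicalSpace M] [ChartedSpace H M]
  {E' : Type*} [NormedAddCommGroup E'] [NormedSpace ℝ E']
  {H' : Type*} [TopologicalSpace H'] {I' : ModelWithCorners ℝ E' H'}
  {N : Type*} [TopologicalSpace N] [ChartedSpace H' N]

/-! ### Riemannian maps, their vertical and horizontal spaces, and their fibres -/

/-- The vertical space `ker φ_{*p}`. -/
def vertical (I : ModelWithCorners ℝ E H) (I' : ModelWithCorners ℝ E' H') (φ : M → N) (p : M) :
    Submodule ℝ (TangentSpace I p) :=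
  LinearMap.ker (mfderiv I I' φ p).toLinearMap

/-- The horizontal space `(ker φ_{*p})^⊥`. -/
def horizontal (I' : ModelWithCorners ℝ E' H') (g : FormField I M) (φ : M → N) (p : M) :
    Submodule ℝ (TangentSpace I p) :=
  (g p).orthogonal (vertical I I' φ p)

open Classical in
/-- The projection `𝒱` onto the vertical space along the horizontal space (the two spaces are
complementary if `g` is a Riemannian metric; otherwise the value is `0`). -/
def vertProj (I' : ModelWithCorners ℝ E' H') (g : FormField I M) (φ : M → N) (p : M)
    (u : TangentSpace I p) : TangentSpace I p :=
  if h : IsCompl (vertical I I' φ p) (horizontal I' g φ p) then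
    (Submodule.projectionOnto _ _ h u : TangentSpace I p)
  else 0

/-- The projection `ℋ` onto the horizontal space. -/
def horProj (I' : ModelWithCorners ℝ E' H') (g : FormField I M) (φ : M → N) (p : M)
    (u : TangentSpace I p) : TangentSpace I p :=
  u - vertProj I' g φ p u

/-- Riemannian maps: smooth maps of positive rank everywhere whose differential is isometric on
the horizontal spaces. -/
structure IsRiemannianMap (g : FormField I M) (g' : FormField I' N) (φ : M → N) : Prop where
  smooth : ContMDiff I I' ∞ φ
  rank_pos : ∀ p : M, mfderiv I I' φ p ≠ 0
  isometric : ∀ p : M, ∀ x ∈ horizontal I' g φ p, ∀ y ∈ horizontal I' g φ p,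
    g' (φ p) (mfderiv I I' φ p x) (mfderiv I I' φ p y) = g p x y

/-- The extension of a tangent vector `v` at `p` to the vector field with constant components in
the chart at `p`. -/
def extendConst {p : M} (v : TangentSpace I p) (x : M) : TangentSpace I x :=
  (show E from mfderiv 𝓘(ℝ, E) I (extChartAt I p).symm (extChartAt I p x)
    (mfderiv I 𝓘(ℝ, E) (extChartAt I p) p v))

/-- O'Neill's tensor on vertical vectors, i.e. the second fundamental form of the fibres:
`T_u v = ℋ (∇_u (𝒱 V))` for `u, v ∈ ker φ_{*p}`, where `V` extends `v`. By tensoriality the value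
does not depend on the extension; the one with constant components in the chart at `p` is used. -/
def oneillT (I' : ModelWithCorners ℝ E' H') (g : FormField I M) (φ : M → N) (p : M)
    (u v : TangentSpace I p) : TangentSpace I p :=
  horProj I' g φ p (leviCivita g (fun x => vertProj I' g φ x (extendConst v x)) p u)

/-- `X` is the mean curvature vector field of (the fibres of) `φ`:
`X_p = (1/k) ∑ T_{e_i} e_i` for orthonormal bases `e_1, …, e_k` of `ker φ_{*p}`. -/
def IsMeanCurvatureField (I' : ModelWithCorners ℝ E' H') (g : FormField I M) (φ : M → N)
    (X : ∀ p : M, TangentSpace I p) : Prop :=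
  ∀ (p : M) (k : ℕ) (e : Fin k → TangentSpace I p),
    (∀ i j, g p (e i) (e j) = if i = j then 1 else 0) →
    Submodule.span ℝ (Set.range e) = vertical I I' φ p →
    X p = (k : ℝ)⁻¹ • ∑ i, oneillT I' g φ p (e i) (e i)

/-- Totally umbilical fibres: `T_u v = g(u, v) X` with `X` the mean curvature vector field. -/
def HasTotallyUmbilicalFibres (I' : ModelWithCorners ℝ E' H') (g : FormField I M)
    (φ : M → N) : Prop :=
  ∃ X : ∀ p : M, TangentSpace I p, IsMeanCurvatureField I' g φ X ∧
    ∀ p : M, ∀ u ∈ vertical I I' φ p, ∀ v ∈ vertical I I' φ p,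
      oneillT I' g φ p u v = g p u v • X p

/-- Totally geodesic fibres: `T_u v = 0` for vertical vectors `u, v`. -/
def HasTotallyGeodesicFibres (I' : ModelWithCorners ℝ E' H') (g : FormField I M)
    (φ : M → N) : Prop :=
  ∀ p : M, ∀ u ∈ vertical I I' φ p, ∀ v ∈ vertical I I' φ p, oneillT I' g φ p u v = 0

/-- The angle in `[0, π/2]` between a nonzero vector `v` and the horizontal space; its cosine is
`‖ℋ v‖ / ‖v‖`. -/
def horizontalAngle (I' : ModelWithCorners ℝ E' H') (g : FormField I M) (φ : M → N) (p : M)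
    (v : TangentSpace I p) : ℝ :=
  Real.arccos (Real.sqrt (g p (horProj I' g φ p v) (horProj I' g φ p v)) / Real.sqrt (g p v v))

/-- `φ` is a Clairaut Riemannian map with function `r : M → ℝ⁺`: it is a Riemannian map, and along
every (nonconstant) geodesic making angles `θ` with the horizontal spaces, `r sin θ` is
constant. -/
structure IsClairaut (g : FormField I M) (g' : FormField I' N) (φ : M → N) (r : M → ℝ) :
    Prop where
  riemannian : IsRiemannianMap g g' φ
  pos : ∀ p, 0 < r p
  clairaut : ∀ (γ : ℝ → M) (J : Set ℝ), IsOpen J → J.OrdConnected → IsGeodesicOn g γ J →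
    (∀ t ∈ J, velocity I γ t ≠ 0) →
    ∃ c : ℝ, ∀ t ∈ J, r (γ t) * Real.sin (horizontalAngle I' g φ (γ t) (velocity I γ t)) = c

end Maps

section Warped

variable {E₁ : Type*} [NormedAddCommGroup E₁] [NormedSpace ℝ E₁]
  {H₁ : Type*} [TopologicalSpace H₁] {I₁ : ModelWithCorners ℝ E₁ H₁}
  {M₁ : Type*} [TopologicalSpace M₁] [ChartedSpace H₁ M₁]
  {E₂ : Type*} [NormedAddCommGroup E₂] [NormedSpace ℝ E₂]
  {H₂ : Type*} [TopologicalSpace H₂] {I₂ : ModelWithCorners ℝ E₂ H₂}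
  {M₂ : Type*} [TopologicalSpace M₂] [ChartedSpace H₂ M₂]
  {F₁ : Type*} [NormedAddCommGroup F₁] [NormedSpace ℝ F₁]
  {K₁ : Type*} [TopologicalSpace K₁] {L₁ : ModelWithCorners ℝ F₁ K₁}
  {N₁ : Type*} [TopologicalSpace N₁] [ChartedSpace K₁ N₁]
  {F₂ : Type*} [NormedAddCommGroup F₂] [NormedSpace ℝ F₂]
  {K₂ : Type*} [TopologicalSpace K₂] {L₂ : ModelWithCorners ℝ F₂ K₂}
  {N₂ : Type*} [TopologicalSpace N₂] [ChartedSpace K₂ N₂]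

/-- The metric of the warped product `M₁ ×_f M₂`:
`g(X, Y) = g₁(π₁_* X, π₁_* Y) + f(π₁)² g₂(π₂_* X, π₂_* Y)`. -/
def warped (g₁ : FormField I₁ M₁) (f : M₁ → ℝ) (g₂ : FormField I₂ M₂) :
    FormField (I₁.prod I₂) (M₁ × M₂) :=
  fun p =>
    (g₁ p.1).compl₁₂ (mfderiv (I₁.prod I₂) I₁ (Prod.fst : M₁ × M₂ → M₁) p).toLinearMap
        (mfderiv (I₁.prod I₂) I₁ (Prod.fst : M₁ × M₂ → M₁) p).toLinearMap
      + (f p.1) ^ 2 •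
        (g₂ p.2).compl₁₂ (mfderiv (I₁.prod I₂) I₂ (Prod.snd : M₁ × M₂ → M₂) p).toLinearMap
          (mfderiv (I₁.prod I₂) I₂ (Prod.snd : M₁ × M₂ → M₂) p).toLinearMap

/-- `φ₁ × φ₂ : M₁ ×_f M₂ → N₁ ×_ρ N₂` is a Riemannian warped product map: the factors are
Riemannian maps, and so is the product map with respect to the warped product metrics. -/
structure IsRiemannianWarpedProductMap (g₁ : FormField I₁ M₁) (f : M₁ → ℝ) (g₂ : FormField I₂ M₂)
    (h₁ : FormField L₁ N₁) (ρ : N₁ → ℝ) (h₂ : FormField L₂ N₂)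
    (φ₁ : M₁ → N₁) (φ₂ : M₂ → N₂) : Prop where
  fst : IsRiemannianMap g₁ h₁ φ₁
  snd : IsRiemannianMap g₂ h₂ φ₂
  prod : IsRiemannianMap (warped g₁ f g₂) (warped h₁ ρ h₂) (Prod.map φ₁ φ₂)

end Warped

end ClairautWarped

end

open ClairautWarped

/-!
The theorem follows from one formula for the second fundamental form of the fibres of a Riemannian
map and one description of the Clairaut condition at a point.

Let `φ : (M, g) → (N, g')` be a Riemannian map. The field of forms `k = g - φ^* g'` (`vertForm`) is
smooth and, since `φ` is isometric on horizontal vectors, it is `g(𝒱 ·, 𝒱 ·)`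
(`IsRiemannianMap.modelForm_vertForm`). The Christoffel symbols of the first kind of a pullback
`φ^* g'` vanish when their last argument is vertical (`christoffelForm_pullback`), so those of `g`
and `k` agree there (`christoffelForm_vertForm`), and neither a constant rank theorem nor charts
adapted to the fibres are needed. For vertical `u`, `v` and horizontal `x` this gives
`g(T_u v, x) = Γ_k(u, v, x)`, where `Γ_k` denotes the Christoffel symbols of `k`
(`IsRiemannianMap.modelForm_modelT`). Along a geodesic with velocity `u + x` it gives
`d/dt k(γ', γ') = 2 g(T_u u, x)`, while `g(γ', γ')` is constant
(`IsGeodesicOn.hasDerivAt_vertForm`, `IsGeodesicOn.hasDerivAt_energy`).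

For `r = e^G` one has `(r sin θ)² = e^{2G} k(γ', γ') / g(γ', γ')`. Differentiating, and using that
every tangent vector is the velocity of a geodesic (`exists_isGeodesicOn`), the map is Clairaut with
`r = e^G` if and only if `dG(u + x) g(u, u) + g(T_u u, x) = 0` for all vertical `u` and horizontal
`x` at every point (`isClairaut_iff`).

For a Riemannian warped product map, `ρ ∘ φ₁ = f` (`IsRiemannianWarpedProductMap.comp_eq`), so
`k = k₁ + f² k₂` (`vertForm_warped`), whence
`g(T_u v, x) = g₁(T_{u₁} v₁, x₁) + f² g₂(T_{u₂} v₂, x₂) - f df(x₁) g₂(u₂, v₂)`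
(`IsRiemannianWarpedProductMap.modelForm_modelT`). Inserting vectors with only one nonzero component
into the pointwise condition shows that it means: `dG = d ln f`, the fibres of `φ₂` are totally
geodesic, and `T_u v = -g₁(u, v) ∇ ln f` for `φ₁` (`WarpedSetup.clairautCondition_iff`). Taking the
trace of the formula for `T` over an orthonormal basis of the vertical space compares this with the
condition on the mean curvature of `φ` (`WarpedSetup.hasLogUmbilicalFibres`,
`WarpedSetup.isMeanCurvatureField`).

The tangent spaces of `M` are by definition the model space `E`. The definitions whose names begin
with `model` restate the notions on tangent spaces with values in `E`, where Mathlib finds the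
normed space structure.
-/

noncomputable section

set_option maxSynthPendingDepth 3
set_option linter.unusedSectionVars false

open Filter Topology

namespace ClairautWarped

/-! ### Christoffel symbols of fields of bilinear forms on a vector space -/

section VectorSpace

variable {E : Type*} [NormedAddCommGroup E] [NormedSpace ℝ E]
  {E' : Type*} [NormedAddCommGroup E'] [NormedSpace ℝ E']

/-- The Christoffel symbol of the first kind
`½ (∂_u B(v, w) + ∂_v B(u, w) - ∂_w B(u, v))` at `y` of a field `B` of continuous bilinear forms
on a vector space. The forms need not be nondegenerate. -/
def christoffelForm (B : E → E →L[ℝ] E →L[ℝ] ℝ) (y u v w : E) : ℝ :=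
  (fderiv ℝ B y u v w + fderiv ℝ B y v u w - fderiv ℝ B y w u v) / 2

/-- The Christoffel symbol of the first kind as a continuous linear form in its last vector. -/
def christoffelDual (B : E → E →L[ℝ] E →L[ℝ] ℝ) (y u v : E) : E →L[ℝ] ℝ :=
  (2⁻¹ : ℝ) • (fderiv ℝ B y u v + fderiv ℝ B y v u - ((fderiv ℝ B y).flip u).flip v)

@[simp] lemma christoffelDual_apply (B : E → E →L[ℝ] E →L[ℝ] ℝ) (y u v w : E) :
    christoffelDual B y u v w = christoffelForm B y u v w := by
  simp [christoffelDual, christoffelForm, div_eq_inv_mul]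

lemma fderiv_form_apply {B : E' → E →L[ℝ] E →L[ℝ] ℝ} {y : E'} (hB : DifferentiableAt ℝ B y)
    (w : E') (u v : E) : fderiv ℝ (fun z => B z u v) y w = fderiv ℝ B y w u v := by
  have h := (hB.hasFDerivAt.clm_apply (hasFDerivAt_const u y)).clm_apply (hasFDerivAt_const v y)
  rw [h.fderiv]
  simp

lemma fderiv_form_sub {A B C : E → E →L[ℝ] E →L[ℝ] ℝ} {y : E} (hA : DifferentiableAt ℝ A y)
    (hB : DifferentiableAt ℝ B y) (hC : DifferentiableAt ℝ C y)
    (h : ∀ z a b, C z a b = A z a b - B z a b) (w a b : E) :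
    fderiv ℝ C y w a b = fderiv ℝ A y w a b - fderiv ℝ B y w a b := by
  have hA' : DifferentiableAt ℝ (fun z => A z a b) y := by fun_prop
  have hB' : DifferentiableAt ℝ (fun z => B z a b) y := by fun_prop
  rw [← fderiv_form_apply hA, ← fderiv_form_apply hB, ← fderiv_form_apply hC]
  simp only [h, fderiv_fun_sub hA' hB', sub_apply]

lemma fderiv_form_symm {B : E → E →L[ℝ] E →L[ℝ] ℝ} {y : E} (hB : DifferentiableAt ℝ B y)
    (hs : ∀ᶠ z in 𝓝 y, ∀ a b, B z a b = B z b a) (w u v : E) :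
    fderiv ℝ B y w u v = fderiv ℝ B y w v u := by
  rw [← fderiv_form_apply hB, ← fderiv_form_apply hB]
  congr 1
  exact Filter.EventuallyEq.fderiv_eq (hs.mono fun z hz => hz u v)

/-- The transformation law of the Christoffel symbols of the first kind under pullback along a
`C²` map `F`. It holds for degenerate forms and noninvertible maps as well. -/
lemma christoffelForm_pullback {A : E → E →L[ℝ] E →L[ℝ] ℝ} {B : E' → E' →L[ℝ] E' →L[ℝ] ℝ}
    {F : E → E'} {y : E} (hF : ContDiffAt ℝ 2 F y) (hB : DifferentiableAt ℝ B (F y))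
    (hA : DifferentiableAt ℝ A y)
    (hs : ∀ a b, B (F y) a b = B (F y) b a)
    (h : ∀ᶠ z in 𝓝 y, ∀ a b, A z a b = B (F z) (fderiv ℝ F z a) (fderiv ℝ F z b)) (u v w : E) :
    christoffelForm A y u v w
      = christoffelForm B (F y) (fderiv ℝ F y u) (fderiv ℝ F y v) (fderiv ℝ F y w)
        + B (F y) (fderiv ℝ (fderiv ℝ F) y u v) (fderiv ℝ F y w) := by
  have hF1 : HasFDerivAt F (fderiv ℝ F y) y := (hF.differentiableAt (by simp)).hasFDerivAt
  have hF2 : HasFDerivAt (fderiv ℝ F) (fderiv ℝ (fderiv ℝ F) y) y :=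
    ((hF.fderiv_right (m := 1) (by norm_num)).differentiableAt (by simp)).hasFDerivAt
  have key : ∀ w a b : E, fderiv ℝ A y w a b
      = fderiv ℝ B (F y) (fderiv ℝ F y w) (fderiv ℝ F y a) (fderiv ℝ F y b)
        + B (F y) (fderiv ℝ (fderiv ℝ F) y w a) (fderiv ℝ F y b)
        + B (F y) (fderiv ℝ F y a) (fderiv ℝ (fderiv ℝ F) y w b) := by
    intro w a b
    rw [← fderiv_form_apply hA,
      Filter.EventuallyEq.fderiv_eq (f := fun z => B (F z) (fderiv ℝ F z a) (fderiv ℝ F z b))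
        (h.mono fun z hz => hz a b)]
    have hBF : HasFDerivAt (fun z => B (F z)) ((fderiv ℝ B (F y)).comp (fderiv ℝ F y)) y :=
      HasFDerivAt.comp (G := E' →L[ℝ] E' →L[ℝ] ℝ) y hB.hasFDerivAt hF1
    have hFa : ∀ c, HasFDerivAt (fun z => fderiv ℝ F z c) ((fderiv ℝ (fderiv ℝ F) y).flip c) y := by
      intro c
      simpa using hF2.clm_apply (hasFDerivAt_const c y)
    have h1 : HasFDerivAt (fun z => B (F z) (fderiv ℝ F z a) (fderiv ℝ F z b)) _ y :=
      (hBF.clm_apply (hFa a)).clm_apply (hFa b)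
    rw [h1.fderiv]
    simp
    ring
  have hsym : ∀ a b, fderiv ℝ (fderiv ℝ F) y a b = fderiv ℝ (fderiv ℝ F) y b a := fun a b =>
    hF.isSymmSndFDerivAt (by simp) a b
  simp only [christoffelForm, key]
  rw [hsym v u, hsym w u, hsym w v, hs (fderiv ℝ F y u) (fderiv ℝ (fderiv ℝ F) y v w),
    hs (fderiv ℝ F y v) (fderiv ℝ (fderiv ℝ F) y u w)]
  ring

/-- The derivative of `B(x', x')` along a curve `x`. -/
lemma hasDerivAt_form_velocity {B : E → E →L[ℝ] E →L[ℝ] ℝ} {x x' : ℝ → E} {t : ℝ} {a : E}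
    (hB : DifferentiableAt ℝ B (x t)) (hx : HasDerivAt x (x' t) t) (hx' : HasDerivAt x' a t) :
    HasDerivAt (fun s => B (x s) (x' s) (x' s))
      (fderiv ℝ B (x t) (x' t) (x' t) (x' t) + B (x t) a (x' t) + B (x t) (x' t) a) t := by
  have hBx : HasDerivAt (fun s => B (x s)) (fderiv ℝ B (x t) (x' t)) t :=
    HasFDerivAt.comp_hasDerivAt (F := E) (E := E →L[ℝ] E →L[ℝ] ℝ) t hB.hasFDerivAt hx
  have h1 : HasDerivAt (fun s => B (x s) (x' s) (x' s)) _ t := (hBx.clm_apply hx').clm_apply hx'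
  convert h1 using 1
  simp

/-- A pointwise decomposition of a field `g` of bilinear forms as `k + (g - k)` with both summands
positive semidefinite, where at `y` the form `k` is the part of `g` on `Ver` (with radical
containing `Hor`), and where the Christoffel symbols of `g - k` vanish on `Ver` in the last slot.
For a Riemannian map, `g - k` is the pullback of the metric of the target. -/
structure IsVerticalForm (g k : E → E →L[ℝ] E →L[ℝ] ℝ) (y : E) (Ver Hor : Submodule ℝ E) :
    Prop where
  diff_g : DifferentiableAt ℝ g y
  diff_k : DifferentiableAt ℝ k y
  symm_g : ∀ᶠ z in 𝓝 y, ∀ a b, g z a b = g z b a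
  symm_k : ∀ᶠ z in 𝓝 y, ∀ a b, k z a b = k z b a
  nonneg : ∀ᶠ z in 𝓝 y, ∀ a, 0 ≤ k z a a
  le : ∀ᶠ z in 𝓝 y, ∀ a, k z a a ≤ g z a a
  hor : ∀ x ∈ Hor, ∀ w, k y x w = 0
  ver : ∀ u ∈ Ver, ∀ w, k y u w = g y u w
  pullback : ∀ u ∈ Ver, ∀ a b, christoffelForm g y a b u = christoffelForm k y a b u

namespace IsVerticalForm

variable {g k : E → E →L[ℝ] E →L[ℝ] ℝ} {y : E} {Ver Hor : Submodule ℝ E}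

/-- A nonnegative function has zero derivative where it vanishes; polarisation gives the mixed
terms. -/
lemma fderiv_hor (h : IsVerticalForm g k y Ver Hor) {x x' : E} (hx : x ∈ Hor) (hx' : x' ∈ Hor)
    (w : E) : fderiv ℝ k y w x x' = 0 := by
  have diag : ∀ a ∈ Hor, fderiv ℝ k y w a a = 0 := by
    intro a ha
    rw [← fderiv_form_apply h.diff_k]
    have : IsLocalMin (fun z => k z a a) y := by
      filter_upwards [h.nonneg] with z hz
      simpa [h.hor a ha a] using hz a
    rw [this.fderiv_eq_zero]; rfl
  have h1 := diag _ (Hor.add_mem hx hx')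
  have h2 := fderiv_form_symm h.diff_k h.symm_k w x x'
  simp only [map_add, add_apply, diag x hx, diag x' hx'] at h1
  linarith

lemma fderiv_ver (h : IsVerticalForm g k y Ver Hor) {u u' : E} (hu : u ∈ Ver) (hu' : u' ∈ Ver)
    (w : E) : fderiv ℝ g y w u u' = fderiv ℝ k y w u u' := by
  have diag : ∀ a ∈ Ver, fderiv ℝ g y w a a = fderiv ℝ k y w a a := by
    intro a ha
    have e1 : fderiv ℝ (fun z => g z a a - k z a a) y w = 0 := by
      have : IsLocalMin (fun z => g z a a - k z a a) y := by
        filter_upwards [h.le] with z hz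
        simpa [h.ver a ha a] using hz a
      rw [this.fderiv_eq_zero]; rfl
    have hg : DifferentiableAt ℝ (fun z => g z a a) y := by
      have := h.diff_g
      fun_prop
    have hk : DifferentiableAt ℝ (fun z => k z a a) y := by
      have := h.diff_k
      fun_prop
    rw [fderiv_fun_sub hg hk, sub_apply, fderiv_form_apply h.diff_g,
      fderiv_form_apply h.diff_k] at e1
    linarith
  have h1 := diag _ (Ver.add_mem hu hu')
  have h2 := fderiv_form_symm h.diff_k h.symm_k w u u'
  have h3 := fderiv_form_symm h.diff_g h.symm_g w u u'
  simp only [map_add, add_apply, diag u hu, diag u' hu'] at h1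
  linarith

/-- The Christoffel symbol of the vertical form `k` computes the second fundamental form: on the
left stands `g(∇_u (𝒱 V), x)` for the field `V` with constant components `v`. -/
lemma christoffelForm_ver_ver_hor (h : IsVerticalForm g k y Ver Hor) {u v x : E} (hu : u ∈ Ver)
    (hv : v ∈ Ver) :
    fderiv ℝ k y u v x - fderiv ℝ g y u v x + christoffelForm g y u v x
      = christoffelForm k y u v x := by
  have h1 := h.fderiv_ver hu hv x
  have h2 := h.pullback u hu x v
  have h3 := h.fderiv_ver hv hu x
  have h4 := fderiv_form_symm h.diff_g h.symm_g u x v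
  have h5 := fderiv_form_symm h.diff_k h.symm_k u x v
  have h6 := fderiv_form_symm h.diff_g h.symm_g v x u
  have h7 := fderiv_form_symm h.diff_k h.symm_k v x u
  simp only [christoffelForm] at *
  linarith

/-- On the left stands the derivative of `k(γ', γ')` along a geodesic `γ` with velocity `u + x`. -/
lemma christoffelForm_decompose (h : IsVerticalForm g k y Ver Hor) {u x : E} (hu : u ∈ Ver)
    (hx : x ∈ Hor) :
    fderiv ℝ k y (u + x) (u + x) (u + x) - 2 * christoffelForm g y (u + x) (u + x) u
      = 2 * christoffelForm k y u u x := by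
  rw [h.pullback u hu]
  have h1 := h.fderiv_hor hx hx x
  have h2 := h.fderiv_hor hx hx u
  have h3 := fderiv_form_symm h.diff_k h.symm_k u x u
  have h4 := fderiv_form_symm h.diff_k h.symm_k x x u
  simp only [christoffelForm, map_add, add_apply] at *
  linarith

end IsVerticalForm

end VectorSpace

/-! ### Fields of bilinear forms in charts -/

section Charts

variable {E : Type*} [NormedAddCommGroup E] [NormedSpace ℝ E]
  {H : Type*} [TopologicalSpace H] {I : ModelWithCorners ℝ E H}
  {M : Type*} [TopologicalSpace M] [ChartedSpace H M]
  {E' : Type*} [NormedAddCommGroup E'] [NormedSpace ℝ E']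
  {H' : Type*} [TopologicalSpace H'] {I' : ModelWithCorners ℝ E' H'}
  {N : Type*} [TopologicalSpace N] [ChartedSpace H' N]
  {E'' : Type*} [NormedAddCommGroup E''] [NormedSpace ℝ E'']
  {H'' : Type*} [TopologicalSpace H''] {I'' : ModelWithCorners ℝ E'' H''}
  {P : Type*} [TopologicalSpace P] [ChartedSpace H'' P]
  {W : Type*} [NormedAddCommGroup W] [NormedSpace ℝ W]
  {W' : Type*} [NormedAddCommGroup W'] [NormedSpace ℝ W']

/-- The form `g q` on the model space `E`, which is what `TangentSpace I q` unfolds to. Its type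
does not depend on `q`, so that the base point can be rewritten. -/
def modelForm (g : FormField I M) (q : M) : LinearMap.BilinForm ℝ E := g q

/-- The derivative of a map of manifolds as a continuous linear map of the model spaces, which is
what the tangent spaces unfold to. -/
def modelDeriv (I : ModelWithCorners ℝ E H) (I' : ModelWithCorners ℝ E' H') (F : M → N) (p : M) :
    E →L[ℝ] E' := mfderiv I I' F p

lemma modelDeriv_comp {F : M → N} {G : N → P} {p : M} (hG : MDifferentiableAt I' I'' G (F p))
    (hF : MDifferentiableAt I I' F p) (u : E) :
    modelDeriv I I'' (fun q => G (F q)) p u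
      = modelDeriv I' I'' G (F p) (modelDeriv I I' F p u) :=
  congrArg (fun L : E →L[ℝ] E'' => L u) (mfderiv_comp p hG hF)

lemma modelDeriv_congr {F G : M → N} {p : M} (h : F =ᶠ[𝓝 p] G) :
    modelDeriv I I' F p = modelDeriv I I' G p := h.mfderiv_eq

lemma modelDeriv_eq_fderiv (F : W → W') (z : W) :
    modelDeriv 𝓘(ℝ, W) 𝓘(ℝ, W') F z = fderiv ℝ F z := mfderiv_eq_fderiv

lemma chartMetric_eq (g : FormField I M) (x₀ : M) (y u v : E) :
    chartMetric g x₀ y u v = modelForm g ((extChartAt I x₀).symm y)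
      (modelDeriv 𝓘(ℝ, E) I (extChartAt I x₀).symm y u)
      (modelDeriv 𝓘(ℝ, E) I (extChartAt I x₀).symm y v) := rfl

lemma contMDiffAt_extChartAt_of_mem [IsManifold I ∞ M] {x₀ p : M}
    (hp : p ∈ (extChartAt I x₀).source) :
    ContMDiffAt I 𝓘(ℝ, E) ∞ (extChartAt I x₀) p :=
  contMDiffAt_extChartAt' (by simpa using hp)

lemma modelDeriv_extChartAt_self [IsManifold I ∞ M] (p : M) :
    modelDeriv I 𝓘(ℝ, E) (extChartAt I p) p = .id ℝ E := by
  have : IsManifold I 1 M := IsManifold.of_le (n := ∞) (by simp)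
  exact mfderiv_extChartAt_self (I := I) (x := p)

section Boundaryless

variable [I.Boundaryless] [IsManifold I ∞ M]

lemma contMDiffAt_extChartAt_symm {x₀ : M} {y : E} (hy : y ∈ (extChartAt I x₀).target) :
    ContMDiffAt 𝓘(ℝ, E) I ∞ (extChartAt I x₀).symm y :=
  (contMDiffOn_extChartAt_symm x₀).contMDiffAt ((isOpen_extChartAt_target x₀).mem_nhds hy)

lemma mdifferentiableAt_extChartAt_symm {x₀ : M} {y : E} (hy : y ∈ (extChartAt I x₀).target) :
    MDifferentiableAt 𝓘(ℝ, E) I (extChartAt I x₀).symm y :=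
  (contMDiffAt_extChartAt_symm hy).mdifferentiableAt (by simp)

lemma modelDeriv_extChartAt_symm_self (p : M) :
    modelDeriv 𝓘(ℝ, E) I (extChartAt I p).symm (extChartAt I p p) = .id ℝ E := by
  have : IsManifold I 1 M := IsManifold.of_le (n := ∞) (by simp)
  have h := mfderivWithin_range_extChartAt_symm (I := I) (x := p)
  rwa [I.range_eq_univ, mfderivWithin_univ] at h

lemma modelDeriv_extChartAt_symm_apply {x₀ : M} {y : E} (hy : y ∈ (extChartAt I x₀).target)
    (u : E) : modelDeriv I 𝓘(ℝ, E) (extChartAt I x₀) ((extChartAt I x₀).symm y)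
      (modelDeriv 𝓘(ℝ, E) I (extChartAt I x₀).symm y u) = u := by
  have : IsManifold I 1 M := IsManifold.of_le (n := ∞) (by simp)
  have h := mfderiv_extChartAt_comp_mfderivWithin_extChartAt_symm (I := I) hy
  rw [I.range_eq_univ, mfderivWithin_univ] at h
  exact congrArg (fun L : E →L[ℝ] E => L u) h

lemma modelDeriv_symm_extChartAt_apply {x₀ : M} {y : E} (hy : y ∈ (extChartAt I x₀).target)
    (u : E) : modelDeriv 𝓘(ℝ, E) I (extChartAt I x₀).symm y
      (modelDeriv I 𝓘(ℝ, E) (extChartAt I x₀) ((extChartAt I x₀).symm y) u) = u := by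
  have : IsManifold I 1 M := IsManifold.of_le (n := ∞) (by simp)
  have h := mfderivWithin_extChartAt_symm_comp_mfderiv_extChartAt (I := I) hy
  rw [I.range_eq_univ, mfderivWithin_univ] at h
  exact congrArg (fun L : E →L[ℝ] E => L u) h

lemma chartMetric_self (g : FormField I M) (p : M) (u v : E) :
    chartMetric g p (extChartAt I p p) u v = modelForm g p u v := by
  rw [chartMetric_eq, extChartAt_to_inv, modelDeriv_extChartAt_symm_self]
  rfl

/-- The derivative of a map into `M`, expressed in a chart. -/
lemma modelDeriv_symm_fderiv {x₀ : M} {F : W → M} {z : W}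
    (hF' : MDifferentiableAt 𝓘(ℝ, W) I F z)
    (hz : F z ∈ (extChartAt I x₀).source) (a : W) :
    modelDeriv 𝓘(ℝ, E) I (extChartAt I x₀).symm (extChartAt I x₀ (F z))
      (fderiv ℝ (fun s => extChartAt I x₀ (F s)) z a) = modelDeriv 𝓘(ℝ, W) I F z a := by
  have h1 : MDifferentiableAt I 𝓘(ℝ, E) (extChartAt I x₀) (F z) :=
    (contMDiffAt_extChartAt_of_mem hz).mdifferentiableAt (by simp)
  have h2 : MDifferentiableAt 𝓘(ℝ, E) I (extChartAt I x₀).symm (extChartAt I x₀ (F z)) :=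
    mdifferentiableAt_extChartAt_symm ((extChartAt I x₀).map_source hz)
  have hev : (fun s => (extChartAt I x₀).symm (extChartAt I x₀ (F s))) =ᶠ[𝓝 z] F := by
    filter_upwards [hF'.continuousAt.preimage_mem_nhds
      ((isOpen_extChartAt_source x₀).mem_nhds hz)] with s hs
    exact (extChartAt I x₀).left_inv hs
  rw [← modelDeriv_congr hev, ← modelDeriv_eq_fderiv]
  exact (modelDeriv_comp (F := fun s => extChartAt I x₀ (F s)) h2 (h1.comp z hF') a).symm

/-- The pullback of a field of forms along a map `F` into `M`, computed in a chart. -/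
lemma modelForm_modelDeriv (g : FormField I M) {x₀ : M} {F : W → M} {z : W}
    (hF' : MDifferentiableAt 𝓘(ℝ, W) I F z)
    (hz : F z ∈ (extChartAt I x₀).source) (a b : W) :
    modelForm g (F z) (modelDeriv 𝓘(ℝ, W) I F z a) (modelDeriv 𝓘(ℝ, W) I F z b)
      = chartMetric g x₀ (extChartAt I x₀ (F z))
          (fderiv ℝ (fun s => extChartAt I x₀ (F s)) z a)
          (fderiv ℝ (fun s => extChartAt I x₀ (F s)) z b) := by
  rw [← modelDeriv_symm_fderiv hF' hz a, ← modelDeriv_symm_fderiv hF' hz b, chartMetric_eq,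
    (extChartAt I x₀).left_inv hz]

end Boundaryless

variable [FiniteDimensional ℝ E]

/-- The components of a field of forms in the chart at `x₀`, as a field of continuous bilinear
forms on `E`. -/
def chartForm (g : FormField I M) (x₀ : M) (y : E) : E →L[ℝ] E →L[ℝ] ℝ :=
  LinearMap.toContinuousBilinearMap ((modelForm g ((extChartAt I x₀).symm y)).compl₁₂
    (modelDeriv 𝓘(ℝ, E) I (extChartAt I x₀).symm y).toLinearMap
    (modelDeriv 𝓘(ℝ, E) I (extChartAt I x₀).symm y).toLinearMap)

@[simp] lemma chartForm_apply (g : FormField I M) (x₀ : M) (y u v : E) :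
    chartForm g x₀ y u v = chartMetric g x₀ y u v := rfl

lemma christoffelFirst_eq {g : FormField I M} {x₀ : M} {y : E}
    (hg : DifferentiableAt ℝ (chartForm g x₀) y) (u v w : E) :
    christoffelFirst g x₀ y u v w = christoffelForm (chartForm g x₀) y u v w := by
  simp only [christoffelForm, ← fderiv_form_apply hg]
  rfl

/-- A field of forms with smooth components in the charts. -/
def IsSmoothForm (g : FormField I M) : Prop :=
  ∀ x₀ : M, ContDiffOn ℝ ∞ (chartForm g x₀) (extChartAt I x₀).target

lemma isSmoothForm_of_apply {g : FormField I M} (h : ∀ (x₀ : M) (u v : E),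
    ContDiffOn ℝ ∞ (fun y => chartMetric g x₀ y u v) (extChartAt I x₀).target) :
    IsSmoothForm g := fun x₀ =>
  contDiffOn_clm_apply.2 fun u => contDiffOn_clm_apply.2 fun v => h x₀ u v

lemma IsSmoothForm.contDiffAt [I.Boundaryless] {g : FormField I M} (h : IsSmoothForm g) {x₀ : M}
    {y : E} (hy : y ∈ (extChartAt I x₀).target) : ContDiffAt ℝ ∞ (chartForm g x₀) y :=
  (h x₀).contDiffAt ((isOpen_extChartAt_target x₀).mem_nhds hy)

lemma IsSmoothForm.differentiableAt [I.Boundaryless] {g : FormField I M} (h : IsSmoothForm g)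
    {x₀ : M} {y : E} (hy : y ∈ (extChartAt I x₀).target) :
    DifferentiableAt ℝ (chartForm g x₀) y :=
  ContDiffAt.differentiableAt (F := E →L[ℝ] E →L[ℝ] ℝ) (h.contDiffAt hy) (by simp)

/-- A smooth Riemannian metric, as a property of its field of forms. -/
structure IsMetric (g : FormField I M) : Prop where
  symm : ∀ p u v, g p u v = g p v u
  pos : ∀ p u, u ≠ 0 → 0 < g p u u
  smooth : IsSmoothForm g

lemma RiemMetric.isMetric [I.Boundaryless] [IsManifold I ∞ M] (g : RiemMetric I M) :
    IsMetric g.form where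
  symm p u v := g.symm p u v
  pos p u hu := g.pos p u hu
  smooth := by
    refine isSmoothForm_of_apply fun x₀ u v => ?_
    have hsec : ∀ u : E, ContMDiffOn 𝓘(ℝ, E) I.tangent ∞ (fun y : E =>
        (Bundle.TotalSpace.mk' E ((extChartAt I x₀).symm y)
          (mfderiv 𝓘(ℝ, E) I (extChartAt I x₀).symm y u) : TangentBundle I M))
        (extChartAt I x₀).target := by
      intro u
      have h1 := (contMDiffOn_extChartAt_symm (I := I) (n := ∞) x₀).contMDiffOn_tangentMapWithin
        (m := ∞) (by simp) (isOpen_extChartAt_target x₀).uniqueMDiffOn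
      have h2 : ContMDiffOn 𝓘(ℝ, E) 𝓘(ℝ, E).tangent ∞
          (fun y : E => (⟨y, u⟩ : TangentBundle 𝓘(ℝ, E) E)) (extChartAt I x₀).target :=
        contMDiffOn_vectorSpace_iff_contDiffOn.2 contDiffOn_const
      refine (h1.comp h2 fun y hy => hy).congr fun y hy => ?_
      simp only [Function.comp_apply, tangentMapWithin,
        mfderivWithin_of_isOpen (isOpen_extChartAt_target x₀) hy]
    have hg : ContMDiffOn 𝓘(ℝ, E) (I.prod 𝓘(ℝ, E →L[ℝ] E →L[ℝ] ℝ)) ∞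
        (fun y : E => Bundle.TotalSpace.mk' (E →L[ℝ] E →L[ℝ] ℝ)
          (E := fun x : M => TangentSpace I x →L[ℝ] TangentSpace I x →L[ℝ] ℝ)
          ((extChartAt I x₀).symm y) (g.inner ((extChartAt I x₀).symm y)))
        (extChartAt I x₀).target :=
      g.contMDiff.comp_contMDiffOn (contMDiffOn_extChartAt_symm x₀)
    intro y hy
    have h3 : ContMDiffWithinAt 𝓘(ℝ, E) (I.prod 𝓘(ℝ)) ∞
      (fun m ↦ Bundle.TotalSpace.mk' ℝ (E := Bundle.Trivial M ℝ) ((extChartAt I x₀).symm m)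
        (g.inner ((extChartAt I x₀).symm m) (mfderiv 𝓘(ℝ, E) I (extChartAt I x₀).symm m u)
          (mfderiv 𝓘(ℝ, E) I (extChartAt I x₀).symm m v))) (extChartAt I x₀).target y := by
      apply ContMDiffWithinAt.clm_bundle_apply₂ (F₁ := E) (F₂ := E)
      · exact hg y hy
      · exact hsec u y hy
      · exact hsec v y hy
    simp only [Bundle.contMDiffWithinAt_totalSpace] at h3
    exact h3.2.contDiffWithinAt

end Charts

/-! ### Pullbacks of fields of bilinear forms -/

section Pullback

variable {E : Type*} [NormedAddCommGroup E] [NormedSpace ℝ E]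
  {H : Type*} [TopologicalSpace H] {I : ModelWithCorners ℝ E H}
  {M : Type*} [TopologicalSpace M] [ChartedSpace H M]
  {E' : Type*} [NormedAddCommGroup E'] [NormedSpace ℝ E']
  {H' : Type*} [TopologicalSpace H'] {I' : ModelWithCorners ℝ E' H'}
  {N : Type*} [TopologicalSpace N] [ChartedSpace H' N]

/-- The pullback `φ^* g'` of a field of forms. -/
def pullbackForm (I : ModelWithCorners ℝ E H) (g' : FormField I' N) (φ : M → N) : FormField I M :=
  fun p => (g' (φ p)).compl₁₂ (mfderiv I I' φ p).toLinearMap (mfderiv I I' φ p).toLinearMap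

lemma modelForm_pullbackForm (g' : FormField I' N) (φ : M → N) (p : M) (a b : E) :
    modelForm (pullbackForm I g' φ) p a b
      = modelForm g' (φ p) (modelDeriv I I' φ p a) (modelDeriv I I' φ p b) := rfl

variable [I.Boundaryless] [IsManifold I ∞ M] [I'.Boundaryless] [IsManifold I' ∞ N]

omit [I'.Boundaryless] in
lemma contDiffAt_extChartAt_comp_symm {φ : M → N} (hφ : ContMDiff I I' ∞ φ) {x₀ : M} {x₁ : N}
    {y : E} (hy : y ∈ (extChartAt I x₀).target)
    (hy' : φ ((extChartAt I x₀).symm y) ∈ (extChartAt I' x₁).source) :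
    ContDiffAt ℝ ∞ (fun z => extChartAt I' x₁ (φ ((extChartAt I x₀).symm z))) y :=
  ((contMDiffAt_extChartAt_of_mem hy').comp y
    (hφ.contMDiffAt.comp y (contMDiffAt_extChartAt_symm hy))).contDiffAt

lemma eventually_chartMetric_pullbackForm (g' : FormField I' N) {φ : M → N}
    (hφ : ContMDiff I I' ∞ φ) {x₀ : M} {x₁ : N} {y : E} (hy : y ∈ (extChartAt I x₀).target)
    (hy' : φ ((extChartAt I x₀).symm y) ∈ (extChartAt I' x₁).source) :
    ∀ᶠ z in 𝓝 y, ∀ a b, chartMetric (pullbackForm I g' φ) x₀ z a b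
      = chartMetric g' x₁ (extChartAt I' x₁ (φ ((extChartAt I x₀).symm z)))
          (fderiv ℝ (fun z => extChartAt I' x₁ (φ ((extChartAt I x₀).symm z))) z a)
          (fderiv ℝ (fun z => extChartAt I' x₁ (φ ((extChartAt I x₀).symm z))) z b) := by
  have hc : ContinuousAt (fun z => φ ((extChartAt I x₀).symm z)) y :=
    (hφ.contMDiffAt.comp y (contMDiffAt_extChartAt_symm hy)).continuousAt
  filter_upwards [(isOpen_extChartAt_target x₀).mem_nhds hy,
    hc.preimage_mem_nhds ((isOpen_extChartAt_source x₁).mem_nhds hy')] with z hz hz' a b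
  have h1 : MDifferentiableAt I I' φ ((extChartAt I x₀).symm z) :=
    hφ.contMDiffAt.mdifferentiableAt (by simp)
  have h2 := mdifferentiableAt_extChartAt_symm (I := I) hz
  rw [← modelForm_modelDeriv (F := fun z => φ ((extChartAt I x₀).symm z)) g' (h1.comp z h2) hz',
    modelDeriv_comp h1 h2, modelDeriv_comp h1 h2, chartMetric_eq, modelForm_pullbackForm]

variable [FiniteDimensional ℝ E] [FiniteDimensional ℝ E']

lemma IsSmoothForm.pullbackForm {g' : FormField I' N} (hg' : IsSmoothForm g') {φ : M → N}
    (hφ : ContMDiff I I' ∞ φ) : IsSmoothForm (pullbackForm I g' φ) := by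
  refine isSmoothForm_of_apply fun x₀ u v y hy => ContDiffAt.contDiffWithinAt ?_
  have hy' := mem_extChartAt_source (I := I') (φ ((extChartAt I x₀).symm y))
  have hF := contDiffAt_extChartAt_comp_symm hφ hy hy'
  have hF' := hF.fderiv_right (m := ∞) (by simp)
  have hB := hg'.contDiffAt ((extChartAt I' _).map_source hy')
  refine ContDiffAt.congr_of_eventuallyEq ?_
    ((eventually_chartMetric_pullbackForm g' hφ hy hy').mono fun z hz => hz u v)
  have hBF := ContDiffAt.comp (G := E' →L[ℝ] E' →L[ℝ] ℝ) y hB hF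
  exact (hBF.clm_apply (hF'.clm_apply contDiffAt_const)).clm_apply
    (hF'.clm_apply contDiffAt_const)

/-- The transformation law of the Christoffel symbols of the first kind under a smooth map. -/
lemma christoffelForm_pullbackForm {g' : FormField I' N} (hg' : IsSmoothForm g')
    (hs : ∀ p u v, g' p u v = g' p v u) {φ : M → N}
    (hφ : ContMDiff I I' ∞ φ) {x₀ : M} {x₁ : N} {y : E} (hy : y ∈ (extChartAt I x₀).target)
    (hy' : φ ((extChartAt I x₀).symm y) ∈ (extChartAt I' x₁).source) (u v w : E) :
    let F := fun z => extChartAt I' x₁ (φ ((extChartAt I x₀).symm z))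
    christoffelForm (chartForm (ClairautWarped.pullbackForm I g' φ) x₀) y u v w
      = christoffelForm (chartForm g' x₁) (F y) (fderiv ℝ F y u) (fderiv ℝ F y v) (fderiv ℝ F y w)
        + chartMetric g' x₁ (F y) (fderiv ℝ (fderiv ℝ F) y u v) (fderiv ℝ F y w) :=
  christoffelForm_pullback ((contDiffAt_extChartAt_comp_symm hφ hy hy').of_le (by norm_cast))
    (hg'.differentiableAt ((extChartAt I' x₁).map_source hy'))
    ((hg'.pullbackForm hφ).differentiableAt hy) (fun _ _ => hs _ _ _)
    (eventually_chartMetric_pullbackForm g' hφ hy hy') u v w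

end Pullback

/-! ### Christoffel symbols of the second kind and gradients -/

section Christoffel

variable {E : Type*} [NormedAddCommGroup E] [NormedSpace ℝ E] [FiniteDimensional ℝ E]
  {H : Type*} [TopologicalSpace H] {I : ModelWithCorners ℝ E H}
  {M : Type*} [TopologicalSpace M] [ChartedSpace H M]

lemma exists_equiv_dual_of_pos {B : E →L[ℝ] E →L[ℝ] ℝ} (hB : ∀ u, u ≠ 0 → 0 < B u u) :
    ∃ e : E ≃L[ℝ] (E →L[ℝ] ℝ), (e : E →L[ℝ] E →L[ℝ] ℝ) = B := by
  have hinj : Function.Injective B.toLinearMap := by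
    rw [injective_iff_map_eq_zero]
    intro u hu
    by_contra h
    have h1 : B u = 0 := hu
    have h2 := hB u h
    simp [h1] at h2
  have hdim : finrank ℝ E = finrank ℝ (E →L[ℝ] ℝ) := by
    rw [← (LinearMap.toContinuousLinearMap (𝕜 := ℝ) (E := E) (F' := ℝ)).finrank_eq]
    exact (Subspace.dual_finrank_eq (K := ℝ) (V := E)).symm
  exact ⟨(LinearEquiv.ofInjectiveOfFinrankEq B.toLinearMap hinj hdim).toContinuousLinearEquiv,
    by ext; rfl⟩

variable [I.Boundaryless] [IsManifold I ∞ M] {g : FormField I M}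

omit [FiniteDimensional ℝ E] in
lemma chartMetric_pos (hpos : ∀ p u, u ≠ 0 → 0 < g p u u) {x₀ : M} {y : E}
    (hy : y ∈ (extChartAt I x₀).target) (u : E) (hu : u ≠ 0) : 0 < chartMetric g x₀ y u u := by
  refine hpos _ _ fun h => hu ?_
  have h1 : modelDeriv 𝓘(ℝ, E) I (extChartAt I x₀).symm y u = 0 := h
  rw [← modelDeriv_extChartAt_symm_apply hy u, h1, map_zero]

/-- The equation defining the Christoffel symbols of the second kind has a solution. -/
lemma chartMetric_christoffel (hg : IsMetric g) {x₀ : M} {y : E}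
    (hy : y ∈ (extChartAt I x₀).target) (u v w : E) :
    chartMetric g x₀ y (christoffel g x₀ y u v) w
      = christoffelForm (chartForm g x₀) y u v w := by
  have hd := hg.smooth.differentiableAt hy
  obtain ⟨e, he⟩ := exists_equiv_dual_of_pos (B := chartForm g x₀ y) (chartMetric_pos hg.pos hy)
  have hex : ∃ a : E, (fun w => chartMetric g x₀ y a w)
      = fun w => christoffelFirst g x₀ y u v w := by
    refine ⟨e.symm (christoffelDual (chartForm g x₀) y u v), funext fun w => ?_⟩
    have h1 : chartForm g x₀ y (e.symm (christoffelDual (chartForm g x₀) y u v))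
        = christoffelDual (chartForm g x₀) y u v := by
      rw [← he]; exact e.apply_symm_apply _
    rw [christoffelFirst_eq hd, ← chartForm_apply, h1, christoffelDual_apply]
  have := congrFun (Function.invFun_eq (f := fun (a w : E) => chartMetric g x₀ y a w) hex) w
  rw [← christoffelFirst_eq hd]
  exact this

omit [FiniteDimensional ℝ E] in
lemma chartMetric_ext (hpos : ∀ p u, u ≠ 0 → 0 < g p u u) {x₀ : M} {y : E}
    (hy : y ∈ (extChartAt I x₀).target) {a b : E}
    (h : ∀ w, chartMetric g x₀ y a w = chartMetric g x₀ y b w) : a = b := by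
  by_contra hab
  have h1 := chartMetric_pos hpos hy (a - b) (sub_ne_zero.2 hab)
  have h2 : ∀ c, chartMetric g x₀ y (a - b) c = 0 := by
    intro c
    have := h c
    rw [chartMetric_eq, chartMetric_eq] at this
    rw [chartMetric_eq, map_sub, map_sub, LinearMap.sub_apply, this, sub_self]
  exact h1.ne' (h2 _)

lemma chartForm_christoffel (hg : IsMetric g) {x₀ : M} {y : E}
    (hy : y ∈ (extChartAt I x₀).target) (u v : E) :
    chartForm g x₀ y (christoffel g x₀ y u v) = christoffelDual (chartForm g x₀) y u v := by
  ext w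
  rw [chartForm_apply, chartMetric_christoffel hg hy, christoffelDual_apply]

/-- If `g(X, ·)` is a `C^n` function of a parameter, so is `X`. -/
lemma contDiffAt_of_chartForm_apply {F : Type*} [NormedAddCommGroup F] [NormedSpace ℝ F]
    {n : ℕ∞} (hg : IsMetric g) {x₀ : M} {Y : F → E} {X : F → E} {L : F → E →L[ℝ] ℝ} {z : F}
    (hz : Y z ∈ (extChartAt I x₀).target) (hY : ContDiffAt ℝ n Y z) (hL : ContDiffAt ℝ n L z)
    (h : ∀ᶠ s in 𝓝 z, chartForm g x₀ (Y s) (X s) = L s) : ContDiffAt ℝ n X z := by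
  obtain ⟨e, he⟩ := exists_equiv_dual_of_pos (B := chartForm g x₀ (Y z)) (chartMetric_pos hg.pos hz)
  have hB : ContDiffAt ℝ n (fun s => chartForm g x₀ (Y s)) z :=
    ContDiffAt.comp (g := chartForm g x₀) (f := Y) z ((hg.smooth.contDiffAt hz).of_le
      (by norm_cast; exact le_top)) hY
  have hinv : ContDiffAt ℝ n (fun s => (chartForm g x₀ (Y s)).inverse) z := by
    have h1 : ContDiffAt ℝ n ContinuousLinearMap.inverse (chartForm g x₀ (Y z)) := by
      rw [← he]
      exact contDiffAt_map_inverse e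
    exact ContDiffAt.comp (F := E →L[ℝ] E →L[ℝ] ℝ) (G := (E →L[ℝ] ℝ) →L[ℝ] E) z h1 hB
  refine (hinv.clm_apply hL).congr_of_eventuallyEq ?_
  filter_upwards [h, hY.continuousAt.preimage_mem_nhds
    ((isOpen_extChartAt_target x₀).mem_nhds hz)] with s hs hs'
  obtain ⟨e', he'⟩ := exists_equiv_dual_of_pos (B := chartForm g x₀ (Y s))
    (chartMetric_pos hg.pos hs')
  rw [← hs, ← he', ContinuousLinearMap.inverse_equiv]
  exact (e'.symm_apply_apply _).symm

lemma contDiffAt_christoffel (hg : IsMetric g) {x₀ : M} {y : E}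
    (hy : y ∈ (extChartAt I x₀).target) (v : E) :
    ContDiffAt ℝ 1 (fun q : E × E => christoffel g x₀ q.1 q.2 q.2) (y, v) := by
  have hnhds : ∀ᶠ q : E × E in 𝓝 (y, v), q.1 ∈ (extChartAt I x₀).target :=
    continuousAt_fst.preimage_mem_nhds ((isOpen_extChartAt_target x₀).mem_nhds hy)
  refine contDiffAt_of_chartForm_apply (n := 1) (Y := Prod.fst)
    (L := fun q => christoffelDual (chartForm g x₀) q.1 q.2 q.2) hg hy contDiffAt_fst ?_
    (hnhds.mono fun q hq => chartForm_christoffel hg hq _ _)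
  have hopen : IsOpen ((extChartAt I x₀).target ×ˢ (univ : Set E)) :=
    (isOpen_extChartAt_target x₀).prod isOpen_univ
  refine (contDiffOn_clm_apply.2 fun w => ?_).contDiffAt (hopen.mem_nhds ⟨hy, mem_univ v⟩)
  simp only [christoffelDual_apply, christoffelForm]
  intro q hq
  have hd : ContDiffAt ℝ 1 (fderiv ℝ (chartForm g x₀)) q.1 :=
    ContDiffAt.fderiv_right (F := E →L[ℝ] E →L[ℝ] ℝ) (hg.smooth.contDiffAt hq.1)
      (by norm_cast)
  have hd' : ContDiffAt ℝ 1 (fun q : E × E => fderiv ℝ (chartForm g x₀) q.1) q :=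
    ContDiffAt.comp (G := E →L[ℝ] E →L[ℝ] E →L[ℝ] ℝ) q hd contDiffAt_fst
  have h2 : ContDiffAt ℝ 1 (fun q : E × E => q.2) q := contDiffAt_snd
  have hw : ContDiffAt ℝ 1 (fun _ : E × E => w) q := contDiffAt_const
  exact ((((((hd'.clm_apply h2).clm_apply h2).clm_apply hw).add
    (((hd'.clm_apply h2).clm_apply h2).clm_apply hw)).sub
    (((hd'.clm_apply hw).clm_apply h2).clm_apply h2)).div_const 2).contDiffWithinAt

omit [I.Boundaryless] [IsManifold I ∞ M] in
lemma modelForm_gradient (hg : ∀ p u, u ≠ 0 → 0 < g p u u) (h : M → ℝ) (p : M) (w : E) :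
    modelForm g p (gradient g h p) w = modelDeriv I 𝓘(ℝ, ℝ) h p w := by
  obtain ⟨e, he⟩ := exists_equiv_dual_of_pos
    (B := LinearMap.toContinuousBilinearMap (modelForm g p)) (hg p)
  have hex : ∃ a : TangentSpace I p, (fun w : TangentSpace I p => g p a w)
      = fun w => (mfderiv I 𝓘(ℝ, ℝ) h p w : ℝ) := by
    refine ⟨(e.symm (modelDeriv I 𝓘(ℝ, ℝ) h p) : E), funext fun w => ?_⟩
    have h1 : LinearMap.toContinuousBilinearMap (modelForm g p)
        (e.symm (modelDeriv I 𝓘(ℝ, ℝ) h p)) = modelDeriv I 𝓘(ℝ, ℝ) h p := by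
      rw [← he]; exact e.apply_symm_apply _
    exact congrArg (fun L : E →L[ℝ] ℝ => L w) h1
  exact congrFun (Function.invFun_eq
    (f := fun (a w : TangentSpace I p) => g p a w) hex) w

end Christoffel

/-! ### The vertical part of the metric of a Riemannian map -/

section Vertical

variable {E : Type*} [NormedAddCommGroup E] [NormedSpace ℝ E]
  {H : Type*} [TopologicalSpace H] {I : ModelWithCorners ℝ E H}
  {M : Type*} [TopologicalSpace M] [ChartedSpace H M]
  {E' : Type*} [NormedAddCommGroup E'] [NormedSpace ℝ E']
  {H' : Type*} [TopologicalSpace H'] {I' : ModelWithCorners ℝ E' H'}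
  {N : Type*} [TopologicalSpace N] [ChartedSpace H' N]

/-- The vertical space as a subspace of the model space. -/
def modelVertical (I : ModelWithCorners ℝ E H) (I' : ModelWithCorners ℝ E' H') (φ : M → N)
    (p : M) : Submodule ℝ E := vertical I I' φ p

/-- The horizontal space as a subspace of the model space. -/
def modelHorizontal (I' : ModelWithCorners ℝ E' H') (g : FormField I M) (φ : M → N)
    (p : M) : Submodule ℝ E := horizontal I' g φ p

/-- The projection to the vertical space as a map of the model space. -/
def modelVertProj (I' : ModelWithCorners ℝ E' H') (g : FormField I M) (φ : M → N)
    (p : M) (u : E) : E := vertProj I' g φ p u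

/-- The tensor `T` as a map of the model space. -/
def modelT (I' : ModelWithCorners ℝ E' H') (g : FormField I M) (φ : M → N)
    (p : M) (u v : E) : E := oneillT I' g φ p u v

lemma mem_modelVertical {φ : M → N} {p : M} {u : E} :
    u ∈ modelVertical I I' φ p ↔ modelDeriv I I' φ p u = 0 := Iff.rfl

lemma mem_modelHorizontal {g : FormField I M} {φ : M → N} {p : M} {x : E} :
    x ∈ modelHorizontal I' g φ p ↔ ∀ u ∈ modelVertical I I' φ p, modelForm g p u x = 0 := Iff.rfl

/-- The part `g(𝒱 a, 𝒱 b)` of the metric on the vertical space, as the difference `g - φ^* g'`;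
see `IsRiemannianMap.modelForm_vertForm`. -/
def vertForm (g : FormField I M) (g' : FormField I' N) (φ : M → N) : FormField I M :=
  fun p => g p - pullbackForm I g' φ p

lemma modelForm_vertForm_eq (g : FormField I M) (g' : FormField I' N) (φ : M → N) (p : M)
    (a b : E) : modelForm (vertForm g g' φ) p a b = modelForm g p a b
      - modelForm g' (φ p) (modelDeriv I I' φ p a) (modelDeriv I I' φ p b) := rfl

lemma chartMetric_vertForm (g : FormField I M) (g' : FormField I' N) (φ : M → N) (x₀ : M)
    (y a b : E) : chartMetric (vertForm g g' φ) x₀ y a b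
      = chartMetric g x₀ y a b - chartMetric (pullbackForm I g' φ) x₀ y a b := rfl

variable [FiniteDimensional ℝ E] {g : FormField I M} {g' : FormField I' N} {φ : M → N}

lemma isCompl_vertical_horizontal (hg : IsMetric g) (I' : ModelWithCorners ℝ E' H') (φ : M → N)
    (p : M) : IsCompl (modelVertical I I' φ p) (modelHorizontal I' g φ p) := by
  refine (LinearMap.BilinForm.isCompl_orthogonal_iff_disjoint (B := modelForm g p)
    (LinearMap.IsSymm.isRefl ⟨fun u v => hg.symm p u v⟩)).2 (Submodule.disjoint_def.2 ?_)
  intro u hu hu'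
  by_contra h
  exact (hg.pos p u h).ne' (hu' u hu)

lemma modelVertProj_eq (hg : IsMetric g) (I' : ModelWithCorners ℝ E' H') (φ : M → N)
    (p : M) (u : E) : modelVertProj I' g φ p u
      = Submodule.projectionOnto _ _ (isCompl_vertical_horizontal hg I' φ p) u :=
  dif_pos (isCompl_vertical_horizontal hg I' φ p)

lemma modelVertProj_mem (hg : IsMetric g) (p : M) (u : E) :
    modelVertProj I' g φ p u ∈ modelVertical I I' φ p := by
  rw [modelVertProj_eq hg]
  exact Submodule.coe_mem _

lemma sub_modelVertProj_mem (hg : IsMetric g) (p : M) (u : E) :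
    u - modelVertProj I' g φ p u ∈ modelHorizontal I' g φ p := by
  rw [modelVertProj_eq hg, ← Submodule.projectionOnto_apply_eq_zero_iff
    (isCompl_vertical_horizontal hg I' φ p), map_sub, Submodule.projectionOnto_apply_left, sub_self]

lemma modelVertProj_of_mem (hg : IsMetric g) {p : M} {u : E} (hu : u ∈ modelVertical I I' φ p) :
    modelVertProj I' g φ p u = u := by
  rw [modelVertProj_eq hg, Submodule.projectionOnto_apply_of_mem_left _ hu]

lemma IsMetric.modelForm_symm (hg : IsMetric g) (p : M) (a b : E) :
    modelForm g p a b = modelForm g p b a := hg.symm p a b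

lemma IsMetric.modelForm_nonneg (hg : IsMetric g) (p : M) (a : E) : 0 ≤ modelForm g p a a := by
  by_cases h : a = 0
  · simp [h]
  · exact (hg.pos p a h).le

/-- A map that is isometric on the horizontal spaces splits the metric as
`g(𝒱 ·, ·) + φ^* g'`. -/
lemma IsRiemannianMap.modelForm_vertForm (hφ : IsRiemannianMap g g' φ) (hg : IsMetric g)
    (p : M) (a b : E) :
    modelForm (vertForm g g' φ) p a b = modelForm g p (modelVertProj I' g φ p a) b := by
  have h : ∀ a, modelDeriv I I' φ p a
      = modelDeriv I I' φ p (a - modelVertProj I' g φ p a) := by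
    intro a
    rw [map_sub, mem_modelVertical.1 (modelVertProj_mem hg p a), sub_zero]
  have h1 : modelForm g' (φ p) (modelDeriv I I' φ p (a - modelVertProj I' g φ p a))
      (modelDeriv I I' φ p (b - modelVertProj I' g φ p b))
      = modelForm g p (a - modelVertProj I' g φ p a) (b - modelVertProj I' g φ p b) :=
    hφ.isometric p _ (sub_modelVertProj_mem hg p a) _ (sub_modelVertProj_mem hg p b)
  have h2 : modelForm g p (modelVertProj I' g φ p a) (b - modelVertProj I' g φ p b) = 0 :=
    sub_modelVertProj_mem hg p b _ (modelVertProj_mem hg p a)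
  have h3 : modelForm g p (modelVertProj I' g φ p b) (a - modelVertProj I' g φ p a) = 0 :=
    sub_modelVertProj_mem hg p a _ (modelVertProj_mem hg p b)
  have h4 := hg.modelForm_symm p (modelVertProj I' g φ p b) a
  have h5 := hg.modelForm_symm p (modelVertProj I' g φ p b) (modelVertProj I' g φ p a)
  rw [modelForm_vertForm_eq, h a, h b, h1]
  simp only [map_sub, LinearMap.sub_apply] at *
  linarith

lemma IsRiemannianMap.modelForm_vertForm_self (hφ : IsRiemannianMap g g' φ) (hg : IsMetric g)
    (p : M) (a : E) : modelForm (vertForm g g' φ) p a a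
      = modelForm g p (modelVertProj I' g φ p a) (modelVertProj I' g φ p a) := by
  have h2 : modelForm g p (modelVertProj I' g φ p a) (a - modelVertProj I' g φ p a) = 0 :=
    sub_modelVertProj_mem hg p a _ (modelVertProj_mem hg p a)
  rw [hφ.modelForm_vertForm hg]
  rw [map_sub] at h2
  linarith

variable [FiniteDimensional ℝ E'] [I.Boundaryless] [IsManifold I ∞ M] [I'.Boundaryless]
  [IsManifold I' ∞ N]

lemma IsSmoothForm.vertForm (hg : IsSmoothForm g) (hg' : IsSmoothForm g')
    (hφ : ContMDiff I I' ∞ φ) : IsSmoothForm (vertForm g g' φ) := by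
  intro x₀
  have h : chartForm (ClairautWarped.vertForm g g' φ) x₀
      = fun y => chartForm g x₀ y - chartForm (ClairautWarped.pullbackForm I g' φ) x₀ y := by
    ext y a b; rfl
  rw [h]
  exact ContDiffOn.sub (F := E →L[ℝ] E →L[ℝ] ℝ) (hg x₀) (hg'.pullbackForm hφ x₀)

/-- Since the Christoffel symbols of `φ^* g'` vanish when the last vector is vertical, `g` and its
vertical part have the same ones there. -/
lemma christoffelForm_vertForm (hg : IsMetric g) (hg' : IsMetric g') (hφ : ContMDiff I I' ∞ φ)
    (p : M) {u : E} (hu : u ∈ modelVertical I I' φ p) (a b : E) :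
    christoffelForm (chartForm g p) (extChartAt I p p) a b u
      = christoffelForm (chartForm (vertForm g g' φ) p) (extChartAt I p p) a b u := by
  have hy := mem_extChartAt_target (I := I) p
  have h0 : φ ((extChartAt I p).symm (extChartAt I p p)) ∈ (extChartAt I' (φ p)).source := by
    rw [extChartAt_to_inv]; exact mem_extChartAt_source _
  have hF : fderiv ℝ (fun z => extChartAt I' (φ p) (φ ((extChartAt I p).symm z)))
      (extChartAt I p p) u = 0 := by
    have hφ' : MDifferentiableAt I I' φ ((extChartAt I p).symm (extChartAt I p p)) :=
      hφ.contMDiffAt.mdifferentiableAt (by simp)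
    have hs := mdifferentiableAt_extChartAt_symm (I := I) hy
    rw [← modelDeriv_eq_fderiv]
    rw [modelDeriv_comp (F := fun z => φ ((extChartAt I p).symm z))
      ((contMDiffAt_extChartAt_of_mem h0).mdifferentiableAt (by simp)) (hφ'.comp _ hs),
      modelDeriv_comp hφ' hs, modelDeriv_extChartAt_symm_self, extChartAt_to_inv]
    rw [show modelDeriv I I' φ p (ContinuousLinearMap.id ℝ E u) = 0 from hu, map_zero]
  have h1 := christoffelForm_pullbackForm hg'.smooth hg'.symm hφ hy h0 a b u
  have h2 : christoffelForm (chartForm (pullbackForm I g' φ) p) (extChartAt I p p) a b u = 0 := by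
    refine h1.trans ?_
    rw [hF, ← chartForm_apply, map_zero, add_zero]
    simp only [christoffelForm, map_zero, zero_apply, add_zero, sub_zero, zero_div]
  have hdg := hg.smooth.differentiableAt hy
  have hdh := (hg'.smooth.pullbackForm hφ).differentiableAt hy
  have hdk := (hg.smooth.vertForm hg'.smooth hφ).differentiableAt hy
  have key := fderiv_form_sub hdg hdh hdk fun z a b => chartMetric_vertForm g g' φ p z a b
  simp only [christoffelForm, key] at h2 ⊢
  linarith

/-- The decomposition of the metric of a Riemannian map in the chart at `p`. -/
lemma IsRiemannianMap.isVerticalForm (hφ : IsRiemannianMap g g' φ) (hg : IsMetric g)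
    (hg' : IsMetric g') (p : M) :
    IsVerticalForm (chartForm g p) (chartForm (vertForm g g' φ) p) (extChartAt I p p)
      (modelVertical I I' φ p) (modelHorizontal I' g φ p) where
  diff_g := hg.smooth.differentiableAt (mem_extChartAt_target p)
  diff_k := (hg.smooth.vertForm hg'.smooth hφ.smooth).differentiableAt (mem_extChartAt_target p)
  symm_g := .of_forall fun z a b => hg.symm _ _ _
  symm_k := .of_forall fun z a b => by
    simp only [chartForm_apply, chartMetric_eq, modelForm_vertForm_eq]
    rw [hg.modelForm_symm, hg'.modelForm_symm]
  nonneg := .of_forall fun z a => by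
    rw [chartForm_apply, chartMetric_eq, hφ.modelForm_vertForm_self hg]
    exact hg.modelForm_nonneg _ _
  le := .of_forall fun z a => by
    simp only [chartForm_apply, chartMetric_eq, modelForm_vertForm_eq]
    linarith [hg'.modelForm_nonneg (φ ((extChartAt I p).symm z)) (modelDeriv I I' φ
      ((extChartAt I p).symm z) (modelDeriv 𝓘(ℝ, E) I (extChartAt I p).symm z a))]
  hor x hx w := by
    have h := hφ.modelForm_vertForm hg p w x
    rw [mem_modelHorizontal.1 hx _ (modelVertProj_mem hg p w)] at h
    rw [chartForm_apply, chartMetric_self, ← h, modelForm_vertForm_eq, modelForm_vertForm_eq,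
      hg.modelForm_symm, hg'.modelForm_symm]
  ver u hu w := by
    rw [chartForm_apply, chartForm_apply, chartMetric_self, chartMetric_self,
      modelForm_vertForm_eq, mem_modelVertical.1 hu, map_zero, LinearMap.zero_apply, sub_zero]
  pullback u hu a b := christoffelForm_vertForm hg hg' hφ.smooth p hu a b

end Vertical

/-! ### The second fundamental form of the fibres -/

section SecondFundamentalForm

variable {E : Type*} [NormedAddCommGroup E] [NormedSpace ℝ E] [FiniteDimensional ℝ E]
  {H : Type*} [TopologicalSpace H] {I : ModelWithCorners ℝ E H} [I.Boundaryless]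
  {M : Type*} [TopologicalSpace M] [ChartedSpace H M] [IsManifold I ∞ M]
  {E' : Type*} [NormedAddCommGroup E'] [NormedSpace ℝ E'] [FiniteDimensional ℝ E']
  {H' : Type*} [TopologicalSpace H'] {I' : ModelWithCorners ℝ E' H'} [I'.Boundaryless]
  {N : Type*} [TopologicalSpace N] [ChartedSpace H' N] [IsManifold I' ∞ N]
  {g : FormField I M} {g' : FormField I' N} {φ : M → N}

omit [I.Boundaryless] [IsManifold I ∞ M] [FiniteDimensional ℝ E'] [I'.Boundaryless]
  [IsManifold I' ∞ N] in
lemma modelT_mem (hg : IsMetric g) (p : M) (u v : E) :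
    modelT I' g φ p u v ∈ modelHorizontal I' g φ p :=
  sub_modelVertProj_mem hg p (leviCivita g (fun x => vertProj I' g φ x
    (extendConst (p := p) v x)) p u : E)

omit [FiniteDimensional ℝ E] [I.Boundaryless] [FiniteDimensional ℝ E'] [I'.Boundaryless]
  [IsManifold I' ∞ N] in
lemma chartField_vertProj (p : M) (v z : E) (hz : z ∈ (extChartAt I p).target) :
    chartField (fun x => vertProj I' g φ x (extendConst (p := p) v x)) p z
      = modelDeriv I 𝓘(ℝ, E) (extChartAt I p) ((extChartAt I p).symm z)
          (modelVertProj I' g φ ((extChartAt I p).symm z)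
            (modelDeriv 𝓘(ℝ, E) I (extChartAt I p).symm z v)) := by
  have h : chartField (fun x => vertProj I' g φ x (extendConst (p := p) v x)) p z
      = modelDeriv I 𝓘(ℝ, E) (extChartAt I p) ((extChartAt I p).symm z)
          (modelVertProj I' g φ ((extChartAt I p).symm z)
            (modelDeriv 𝓘(ℝ, E) I (extChartAt I p).symm
              (extChartAt I p ((extChartAt I p).symm z))
              (modelDeriv I 𝓘(ℝ, E) (extChartAt I p) p v))) := rfl
  rw [h, (extChartAt I p).right_inv hz, modelDeriv_extChartAt_self]
  rfl

/-- The second fundamental form of the fibres is given by the Christoffel symbols of the vertical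
part of the metric. -/
lemma IsRiemannianMap.modelForm_modelT (hφ : IsRiemannianMap g g' φ) (hg : IsMetric g)
    (hg' : IsMetric g') (p : M) {u v x : E} (hu : u ∈ modelVertical I I' φ p)
    (hv : v ∈ modelVertical I I' φ p) (hx : x ∈ modelHorizontal I' g φ p) :
    modelForm g p (modelT I' g φ p u v) x
      = christoffelForm (chartForm (vertForm g g' φ) p) (extChartAt I p p) u v x := by
  have hvf := hφ.isVerticalForm hg hg' p
  have hy := mem_extChartAt_target (I := I) p
  set y := extChartAt I p p with hy_def
  set V : ∀ q : M, TangentSpace I q := fun q => vertProj I' g φ q (extendConst (p := p) v q)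
    with hV
  -- the defining property of the components of `𝒱 V`
  have hP : ∀ z ∈ (extChartAt I p).target,
      chartForm g p z (chartField V p z) = chartForm (vertForm g g' φ) p z v := by
    intro z hz
    ext w
    rw [chartForm_apply, chartForm_apply, chartMetric_eq, chartMetric_eq,
      chartField_vertProj p v z hz, modelDeriv_symm_extChartAt_apply hz,
      hφ.modelForm_vertForm hg]
  have hPd : DifferentiableAt ℝ (chartField V p) y := by
    have h1 : ContDiffAt ℝ ∞ (fun z => chartForm (vertForm g g' φ) p z v) y :=
      ((hg.smooth.vertForm hg'.smooth hφ.smooth).contDiffAt hy).clm_apply contDiffAt_const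
    exact (contDiffAt_of_chartForm_apply (n := ⊤) (Y := id) hg hy contDiffAt_id h1
      (Filter.eventually_of_mem ((isOpen_extChartAt_target p).mem_nhds hy) hP)).differentiableAt
        (by simp)
  have hPy : chartField V p y = v := by
    rw [chartField_vertProj p v y hy, hy_def, extChartAt_to_inv, modelDeriv_extChartAt_self,
      modelDeriv_extChartAt_symm_self]
    exact modelVertProj_of_mem hg hv
  obtain ⟨L, hL⟩ : ∃ L : E, L = leviCivita g V p u := ⟨_, rfl⟩
  have hLC : L = fderiv ℝ (chartField V p) y u + christoffel g p y u v := by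
    have h : L = modelDeriv 𝓘(ℝ, E) I (extChartAt I p).symm y
        (fderiv ℝ (chartField V p) y (modelDeriv I 𝓘(ℝ, E) (extChartAt I p) p u)
          + christoffel g p y (modelDeriv I 𝓘(ℝ, E) (extChartAt I p) p u)
            (chartField V p y)) := hL
    rw [h, hPy, hy_def, modelDeriv_extChartAt_self, modelDeriv_extChartAt_symm_self]
    rfl
  -- differentiate `hP`
  have hD : chartForm g p y (fderiv ℝ (chartField V p) y u) x
      = fderiv ℝ (chartForm (vertForm g g' φ) p) y u v x
        - fderiv ℝ (chartForm g p) y u v x := by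
    have h1 : HasFDerivAt (fun z => chartForm g p z (chartField V p z) x) _ y :=
      (hvf.diff_g.hasFDerivAt.clm_apply hPd.hasFDerivAt).clm_apply (hasFDerivAt_const x y)
    have h2 : (fun z => chartForm g p z (chartField V p z) x)
        =ᶠ[𝓝 y] fun z => chartForm (vertForm g g' φ) p z v x := by
      filter_upwards [(isOpen_extChartAt_target p).mem_nhds hy] with z hz
      rw [hP z hz]
    have h3 := congrArg (fun L : E →L[ℝ] ℝ => L u) (h1.fderiv.symm.trans h2.fderiv_eq)
    simp only [fderiv_form_apply hvf.diff_k] at h3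
    rw [← h3]
    simp [hPy]
  have hT : modelT I' g φ p u v = L - modelVertProj I' g φ p L := by rw [hL]; rfl
  have h4 : modelForm g p (modelVertProj I' g φ p L) x = 0 :=
    hx _ (modelVertProj_mem hg p _)
  rw [hT, map_sub, LinearMap.sub_apply, h4, sub_zero, hLC, ← chartMetric_self,
    ← hvf.christoffelForm_ver_ver_hor hu hv, ← chartForm_apply, map_add, add_apply, hD,
    chartForm_apply, chartMetric_christoffel hg hy]

end SecondFundamentalForm

/-! ### Derivatives along geodesics -/

section Geodesics

variable {E : Type*} [NormedAddCommGroup E] [NormedSpace ℝ E] [FiniteDimensional ℝ E]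
  {H : Type*} [TopologicalSpace H] {I : ModelWithCorners ℝ E H} [I.Boundaryless]
  {M : Type*} [TopologicalSpace M] [ChartedSpace H M] [IsManifold I ∞ M]
  {E' : Type*} [NormedAddCommGroup E'] [NormedSpace ℝ E'] [FiniteDimensional ℝ E']
  {H' : Type*} [TopologicalSpace H'] {I' : ModelWithCorners ℝ E' H'} [I'.Boundaryless]
  {N : Type*} [TopologicalSpace N] [ChartedSpace H' N] [IsManifold I' ∞ N]
  {g : FormField I M} {g' : FormField I' N} {φ : M → N}

/-- The velocity of a curve as a vector of the model space. -/
def modelVelocity (I : ModelWithCorners ℝ E H) (γ : ℝ → M) (t : ℝ) : E :=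
  modelDeriv 𝓘(ℝ, ℝ) I γ t 1

/-- The derivative of `B(γ', γ')` along a geodesic `γ`, for a second field of forms `B`. -/
lemma IsGeodesicOn.hasDerivAt_form {γ : ℝ → M} {J : Set ℝ} (hγ : IsGeodesicOn g γ J)
    (hJ : IsOpen J) {B : FormField I M} (hB : IsSmoothForm B) (hs : ∀ p u v, B p u v = B p v u)
    {t : ℝ} (ht : t ∈ J) :
    HasDerivAt (fun s => modelForm B (γ s) (modelVelocity I γ s) (modelVelocity I γ s))
      (let v := modelVelocity I γ t
       let y := extChartAt I (γ t) (γ t)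
       fderiv ℝ (chartForm B (γ t)) y v v v
        - 2 * modelForm B (γ t) (christoffel g (γ t) y v v) v) t := by
  set p := γ t with hp
  have hsrc := mem_extChartAt_source (I := I) p
  have hγt : ∀ s ∈ J, ContMDiffAt 𝓘(ℝ, ℝ) I 2 γ s := fun s hs =>
    (hγ.1 s hs).contMDiffAt (hJ.mem_nhds hs)
  have hd : ∀ s ∈ J, MDifferentiableAt 𝓘(ℝ, ℝ) I γ s := fun s hs =>
    (hγt s hs).mdifferentiableAt (by simp)
  let x : ℝ → E := fun s => extChartAt I p (γ s)
  have hx : ContDiffAt ℝ 2 x t :=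
    (((contMDiffAt_extChartAt_of_mem hsrc).of_le (by norm_cast)).comp t (hγt t ht)).contDiffAt
  have hx1 : HasDerivAt x (deriv x t) t := (hx.differentiableAt (by simp)).hasDerivAt
  have hx2 : HasDerivAt (deriv x) (deriv (deriv x) t) t := by
    have h : ContDiffAt ℝ 1 (deriv x) t := by
      have h1 := (hx.fderiv_right (m := 1) (by norm_num)).clm_apply
        (contDiffAt_const (c := (1 : ℝ)))
      exact h1
    exact (h.differentiableAt (by simp)).hasDerivAt
  have hvel : deriv x t = modelVelocity I γ t := by
    have h := modelDeriv_symm_fderiv (x₀ := p) (hd t ht) hsrc 1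
    rw [← hp, modelDeriv_extChartAt_symm_self] at h
    exact h
  have hgeo : deriv (deriv x) t = - christoffel g p (x t) (deriv x t) (deriv x t) :=
    eq_neg_of_add_eq_zero_left (hγ.2 t ht p hsrc)
  have hev : (fun s => modelForm B (γ s) (modelVelocity I γ s) (modelVelocity I γ s))
      =ᶠ[𝓝 t] fun s => chartForm B p (x s) (deriv x s) (deriv x s) := by
    filter_upwards [hJ.mem_nhds ht, (hd t ht).continuousAt.preimage_mem_nhds
      ((isOpen_extChartAt_source p).mem_nhds hsrc)] with s hs hs'
    exact modelForm_modelDeriv B (hd s hs) hs' 1 1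
  have hBd : DifferentiableAt ℝ (chartForm B p) (x t) :=
    hB.differentiableAt (mem_extChartAt_target p)
  have h1 := (hasDerivAt_form_velocity hBd hx1 hx2).congr_of_eventuallyEq hev
  have hsB : ∀ a b, chartForm B p (x t) a b = chartForm B p (x t) b a := fun a b => hs _ _ _
  refine h1.congr_deriv ?_
  rw [hgeo, hsB (deriv x t), map_neg, neg_apply, chartForm_apply, hvel]
  simp only [x, ← hp, chartMetric_self]
  ring

lemma IsGeodesicOn.hasDerivAt_energy {γ : ℝ → M} {J : Set ℝ} (hγ : IsGeodesicOn g γ J)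
    (hJ : IsOpen J) (hg : IsMetric g) {t : ℝ} (ht : t ∈ J) :
    HasDerivAt (fun s => modelForm g (γ s) (modelVelocity I γ s) (modelVelocity I γ s)) 0 t := by
  refine (hγ.hasDerivAt_form hJ hg.smooth hg.symm ht).congr_deriv ?_
  simp only
  rw [← chartMetric_self, chartMetric_christoffel hg (mem_extChartAt_target _)]
  simp only [christoffelForm]
  ring

/-- The derivative of the squared length of the vertical part of the velocity of a geodesic. -/
lemma IsGeodesicOn.hasDerivAt_vertForm {γ : ℝ → M} {J : Set ℝ} (hγ : IsGeodesicOn g γ J)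
    (hJ : IsOpen J) (hφ : IsRiemannianMap g g' φ) (hg : IsMetric g) (hg' : IsMetric g')
    {t : ℝ} (ht : t ∈ J) {u x : E} (hu : u ∈ modelVertical I I' φ (γ t))
    (hx : x ∈ modelHorizontal I' g φ (γ t)) (hux : modelVelocity I γ t = u + x) :
    HasDerivAt (fun s => modelForm (vertForm g g' φ) (γ s) (modelVelocity I γ s)
        (modelVelocity I γ s))
      (2 * modelForm g (γ t) (modelT I' g φ (γ t) u u) x) t := by
  have hvf := hφ.isVerticalForm hg hg' (γ t)
  have hs : ∀ (p : M) (a b : E),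
      modelForm (vertForm g g' φ) p a b = modelForm (vertForm g g' φ) p b a := by
    intro p a b
    rw [modelForm_vertForm_eq, modelForm_vertForm_eq, hg.modelForm_symm, hg'.modelForm_symm]
  refine (hγ.hasDerivAt_form hJ (hg.smooth.vertForm hg'.smooth hφ.smooth) hs ht).congr_deriv ?_
  have h1 : ∀ a, modelForm (vertForm g g' φ) (γ t) a (u + x) = modelForm g (γ t) a u := by
    intro a
    have hk := hvf.hor x hx a
    have hk' := hvf.ver u hu a
    simp only [chartForm_apply, chartMetric_self] at hk hk'
    rw [hs, map_add, LinearMap.add_apply,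
      hk, hk', add_zero, hg.modelForm_symm]
  rw [hφ.modelForm_modelT hg hg' _ hu hu hx, ← hvf.christoffelForm_decompose hu hx, hux]
  simp only
  rw [h1, ← chartMetric_self g, chartMetric_christoffel hg (mem_extChartAt_target _)]

end Geodesics

/-! ### Existence of geodesics -/

section Existence

variable {E : Type*} [NormedAddCommGroup E] [NormedSpace ℝ E] [FiniteDimensional ℝ E]
  {H : Type*} [TopologicalSpace H] {I : ModelWithCorners ℝ E H} [I.Boundaryless]
  {M : Type*} [TopologicalSpace M] [ChartedSpace H M] [IsManifold I ∞ M]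
  {g : FormField I M}

omit [FiniteDimensional ℝ E] [I.Boundaryless] [IsManifold I ∞ M] in
lemma pullbackForm_id : pullbackForm I g (id : M → M) = g := by
  funext p
  refine LinearMap.ext fun a => LinearMap.ext fun b => ?_
  have h : modelDeriv I I (id : M → M) p = .id ℝ E := mfderiv_id
  change modelForm g p (modelDeriv I I (id : M → M) p a) (modelDeriv I I (id : M → M) p b)
    = modelForm g p a b
  rw [h]
  rfl

/-- The geodesic equation is independent of the chart. -/
lemma geodesic_equation_of_chart (hg : IsMetric g) {x₀ x₁ : M} {x : ℝ → E} {t : ℝ}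
    (hx : ContDiffAt ℝ 2 x t) (ht : x t ∈ (extChartAt I x₀).target)
    (ht' : (extChartAt I x₀).symm (x t) ∈ (extChartAt I x₁).source)
    (h : deriv (deriv x) t + christoffel g x₀ (x t) (deriv x t) (deriv x t) = 0) :
    let x' : ℝ → E := fun s => extChartAt I x₁ ((extChartAt I x₀).symm (x s))
    deriv (deriv x') t + christoffel g x₁ (x' t) (deriv x' t) (deriv x' t) = 0 := by
  intro x'
  let τ : E → E := fun z => extChartAt I x₁ ((extChartAt I x₀).symm z)
  have hτ : ContDiffAt ℝ ∞ τ (x t) :=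
    contDiffAt_extChartAt_comp_symm (φ := id) contMDiff_id ht ht'
  have hτt : τ (x t) ∈ (extChartAt I x₁).target := (extChartAt I x₁).map_source ht'
  have hτev : ∀ᶠ z in 𝓝 (x t), DifferentiableAt ℝ τ z := by
    filter_upwards [(hτ.of_le (m := 1) (by norm_cast)).eventually (by simp)] with z hz
    exact hz.differentiableAt (by simp)
  have hxev : ∀ᶠ s in 𝓝 t, DifferentiableAt ℝ x s := by
    filter_upwards [hx.eventually (by simp)] with z hz
    exact hz.differentiableAt (by simp)
  have hd : deriv x' =ᶠ[𝓝 t] fun s => fderiv ℝ τ (x s) (deriv x s) := by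
    filter_upwards [hxev, hx.continuousAt.eventually hτev] with s hs hs'
    exact (hs'.hasFDerivAt.comp_hasDerivAt s hs.hasDerivAt).deriv
  have hx1 : HasDerivAt x (deriv x t) t := (hx.differentiableAt (by simp)).hasDerivAt
  have hx2 : HasDerivAt (deriv x) (deriv (deriv x) t) t := by
    have h : ContDiffAt ℝ 1 (deriv x) t :=
      (hx.fderiv_right (m := 1) (by norm_num)).clm_apply (contDiffAt_const (c := (1 : ℝ)))
    exact (h.differentiableAt (by simp)).hasDerivAt
  have hτ2 : DifferentiableAt ℝ (fderiv ℝ τ) (x t) :=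
    (hτ.fderiv_right (m := 1) (by norm_cast)).differentiableAt (by simp)
  have hdd : deriv (deriv x') t = fderiv ℝ (fderiv ℝ τ) (x t) (deriv x t) (deriv x t)
      + fderiv ℝ τ (x t) (deriv (deriv x) t) := by
    rw [hd.deriv_eq]
    exact ((hτ2.hasFDerivAt.comp_hasDerivAt t hx1).clm_apply hx2).deriv
  have hd0 : deriv x' t = fderiv ℝ τ (x t) (deriv x t) := hd.self_of_nhds
  -- the transition map is isometric for the two coordinate expressions of the metric
  have hiso : ∀ a b, chartMetric g x₁ (τ (x t)) (fderiv ℝ τ (x t) a) (fderiv ℝ τ (x t) b)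
      = chartMetric g x₀ (x t) a b := by
    intro a b
    have h1 := (eventually_chartMetric_pullbackForm (I := I) g (φ := id) contMDiff_id ht
      ht').self_of_nhds a b
    rw [pullbackForm_id] at h1
    exact h1.symm
  have hsurj : Function.Surjective (fderiv ℝ τ (x t)).toLinearMap := by
    rw [← LinearMap.injective_iff_surjective, injective_iff_map_eq_zero]
    intro a ha
    by_contra hne
    have h1 := chartMetric_pos hg.pos ht a hne
    rw [← hiso, show fderiv ℝ τ (x t) a = 0 from ha, ← chartForm_apply] at h1
    simp at h1
  have hch : ∀ w, chartMetric g x₀ (x t) (christoffel g x₀ (x t) (deriv x t) (deriv x t)) w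
      = chartMetric g x₁ (τ (x t)) (christoffel g x₁ (τ (x t)) (fderiv ℝ τ (x t) (deriv x t))
          (fderiv ℝ τ (x t) (deriv x t))) (fderiv ℝ τ (x t) w)
        + chartMetric g x₁ (τ (x t)) (fderiv ℝ (fderiv ℝ τ) (x t) (deriv x t) (deriv x t))
          (fderiv ℝ τ (x t) w) := by
    intro w
    have h1 := christoffelForm_pullbackForm (I := I) (φ := id) hg.smooth hg.symm contMDiff_id ht ht'
      (deriv x t) (deriv x t) w
    rw [pullbackForm_id] at h1
    rw [chartMetric_christoffel hg ht, chartMetric_christoffel hg hτt]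
    exact h1
  rw [hdd, hd0]
  refine chartMetric_ext hg.pos hτt fun w' => ?_
  obtain ⟨w, rfl⟩ := hsurj w'
  have h1 := hch w
  have h2 := eq_neg_of_add_eq_zero_left h
  rw [h2]
  rw [← hiso] at h1
  simp only [← chartForm_apply, map_add, map_neg, add_apply, neg_apply, map_zero, zero_apply,
    ContinuousLinearMap.coe_coe] at h1 ⊢
  have h3 : x' t = τ (x t) := rfl
  rw [h3]
  linarith

lemma exists_isGeodesicOn (hg : IsMetric g) (p : M) (v : E) :
    ∃ γ : ℝ → M, ∃ ε > 0, γ 0 = p ∧ modelVelocity I γ 0 = v ∧ IsGeodesicOn g γ (Ioo (-ε) ε) := by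
  have hy := mem_extChartAt_target (I := I) p
  have hf : ContDiffAt ℝ 1 (fun q : E × E => (q.2, -christoffel g p q.1 q.2 q.2))
      (extChartAt I p p, v) :=
    contDiffAt_snd.prodMk (contDiffAt_christoffel hg hy v).neg
  obtain ⟨α, hα0, ε₀, hε₀, hα⟩ :=
    hf.exists_forall_mem_closedBall_exists_eq_forall_mem_Ioo_hasDerivAt₀ 0
  simp only [zero_sub, zero_add] at hα
  have hαc : ContinuousAt α 0 := (hα 0 ⟨by linarith, hε₀⟩).continuousAt
  have hαx : ContinuousAt (fun s => (α s).1) 0 := hαc.fst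
  have hnhds : ∀ᶠ s in 𝓝 (0 : ℝ), (α s).1 ∈ (extChartAt I p).target :=
    hαx.preimage_mem_nhds ((isOpen_extChartAt_target p).mem_nhds (by rw [hα0]; exact hy))
  obtain ⟨ε₁, hε₁, hball⟩ := Metric.eventually_nhds_iff.1 hnhds
  set ε := min ε₀ ε₁ with hε
  have hε0 : 0 < ε := lt_min hε₀ hε₁
  have hJ : IsOpen (Ioo (-ε) ε) := isOpen_Ioo
  have h0J : (0 : ℝ) ∈ Ioo (-ε) ε := ⟨by linarith, hε0⟩
  have htar : ∀ t ∈ Ioo (-ε) ε, (α t).1 ∈ (extChartAt I p).target := by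
    intro t ht
    apply hball
    rw [Real.dist_eq, sub_zero, abs_lt]
    exact ⟨by linarith [ht.1, min_le_right ε₀ ε₁], by linarith [ht.2, min_le_right ε₀ ε₁]⟩
  have hαd : ∀ t ∈ Ioo (-ε) ε,
      HasDerivAt α ((α t).2, -christoffel g p (α t).1 (α t).2 (α t).2) t := fun t ht =>
    hα t ⟨by linarith [ht.1, min_le_left ε₀ ε₁], by linarith [ht.2, min_le_left ε₀ ε₁]⟩
  let x : ℝ → E := fun s => (α s).1
  let w : ℝ → E := fun s => (α s).2
  have hx : ∀ t ∈ Ioo (-ε) ε, HasDerivAt x (w t) t := fun t ht => (hαd t ht).fst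
  have hw : ∀ t ∈ Ioo (-ε) ε, HasDerivAt w (-christoffel g p (x t) (w t) (w t)) t :=
    fun t ht => (hαd t ht).snd
  have hwC : ContDiffOn ℝ 1 w (Ioo (-ε) ε) := by
    rw [show (1 : ℕ∞ω) = 0 + 1 by norm_num, contDiffOn_succ_iff_deriv_of_isOpen hJ]
    refine ⟨fun t ht => (hw t ht).differentiableAt.differentiableWithinAt, by simp, ?_⟩
    rw [contDiffOn_zero]
    refine ContinuousOn.congr (f := fun t => -christoffel g p (x t) (w t) (w t)) ?_
      fun t ht => (hw t ht).deriv
    intro t ht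
    have h1 : ContinuousAt (fun q : E × E => christoffel g p q.1 q.2 q.2) (α t) :=
      (contDiffAt_christoffel hg (htar t ht) (α t).2).continuousAt
    exact (ContinuousAt.comp (f := α) h1 (hαd t ht).continuousAt).neg.continuousWithinAt
  have hxC : ContDiffOn ℝ 2 x (Ioo (-ε) ε) := by
    rw [show (2 : ℕ∞ω) = 1 + 1 by norm_num, contDiffOn_succ_iff_deriv_of_isOpen hJ]
    exact ⟨fun t ht => (hx t ht).differentiableAt.differentiableWithinAt, by simp,
      hwC.congr fun t ht => (hx t ht).deriv⟩
  have hγC : ∀ t ∈ Ioo (-ε) ε,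
      ContMDiffAt 𝓘(ℝ, ℝ) I 2 (fun s => (extChartAt I p).symm (x s)) t := fun t ht =>
    ((contMDiffAt_extChartAt_symm (htar t ht)).of_le (by norm_cast)).comp t
      (hxC.contDiffAt (hJ.mem_nhds ht)).contMDiffAt
  have hdx : ∀ t ∈ Ioo (-ε) ε, deriv x =ᶠ[𝓝 t] w := fun t ht =>
    Filter.eventually_of_mem (hJ.mem_nhds ht) fun s hs => (hx s hs).deriv
  refine ⟨fun s => (extChartAt I p).symm (x s), ε, hε0, ?_, ?_,
    fun t ht => (hγC t ht).contMDiffWithinAt, ?_⟩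
  · simp only [x, hα0, extChartAt_to_inv]
  · have hx0 : x 0 = extChartAt I p p := by simp only [x, hα0]
    have hw0 : w 0 = v := by simp only [w, hα0]
    have h1 : MDifferentiableAt 𝓘(ℝ, ℝ) 𝓘(ℝ, E) x 0 :=
      (hx 0 h0J).differentiableAt.mdifferentiableAt
    rw [modelVelocity, modelDeriv_comp (F := x) (mdifferentiableAt_extChartAt_symm (htar 0 h0J)) h1,
      modelDeriv_eq_fderiv, hx0, modelDeriv_extChartAt_symm_self, ← hw0, ← (hx 0 h0J).deriv]
    rfl
  · intro t ht x₁ hx₁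
    refine geodesic_equation_of_chart hg (hxC.contDiffAt (hJ.mem_nhds ht)) (htar t ht) hx₁ ?_
    rw [(hdx t ht).deriv_eq, (hx t ht).deriv, (hw t ht).deriv, neg_add_cancel]

end Existence

/-! ### Clairaut's relation -/

section Clairaut

variable {E : Type*} [NormedAddCommGroup E] [NormedSpace ℝ E] [FiniteDimensional ℝ E]
  {H : Type*} [TopologicalSpace H] {I : ModelWithCorners ℝ E H} [I.Boundaryless]
  {M : Type*} [TopologicalSpace M] [ChartedSpace H M] [IsManifold I ∞ M]
  {E' : Type*} [NormedAddCommGroup E'] [NormedSpace ℝ E'] [FiniteDimensional ℝ E']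
  {H' : Type*} [TopologicalSpace H'] {I' : ModelWithCorners ℝ E' H'} [I'.Boundaryless]
  {N : Type*} [TopologicalSpace N] [ChartedSpace H' N] [IsManifold I' ∞ N]
  {g : FormField I M} {g' : FormField I' N} {φ : M → N}

omit [I.Boundaryless] [IsManifold I ∞ M] [FiniteDimensional ℝ E'] [I'.Boundaryless]
  [IsManifold I' ∞ N] in
lemma IsRiemannianMap.sin_horizontalAngle (hφ : IsRiemannianMap g g' φ) (hg : IsMetric g)
    (p : M) {v : E} (hv : v ≠ 0) :
    Real.sin (horizontalAngle I' g φ p v)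
      = √(modelForm (vertForm g g' φ) p v v / modelForm g p v v) := by
  have hpos : 0 < modelForm g p v v := hg.pos p v hv
  have h1 : Real.sin (horizontalAngle I' g φ p v)
      = √(1 - (√(modelForm g p (v - modelVertProj I' g φ p v) (v - modelVertProj I' g φ p v))
        / √(modelForm g p v v)) ^ 2) := Real.sin_arccos _
  have h2 : modelForm g p (modelVertProj I' g φ p v) (v - modelVertProj I' g φ p v) = 0 :=
    sub_modelVertProj_mem hg p v _ (modelVertProj_mem hg p v)
  have h3 := hg.modelForm_symm p v (modelVertProj I' g φ p v)
  rw [h1, div_pow, Real.sq_sqrt (hg.modelForm_nonneg p _), Real.sq_sqrt hpos.le,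
    one_sub_div hpos.ne', hφ.modelForm_vertForm_self hg]
  congr 2
  simp only [map_sub, LinearMap.sub_apply] at *
  linarith

lemma exists_eq_const_of_hasDerivAt_zero {q : ℝ → ℝ} {J : Set ℝ} (hJ : IsOpen J)
    (hJ' : J.OrdConnected) (h : ∀ t ∈ J, HasDerivAt q 0 t) : ∃ c, ∀ t ∈ J, q t = c :=
  hJ.exists_is_const_of_deriv_eq_zero hJ'.isPreconnected
    (fun t ht => (h t ht).differentiableAt.differentiableWithinAt) fun t ht => (h t ht).deriv

/-- Clairaut's relation for `r = e^G`, differentiated at a point where the geodesic has velocity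
`u + x` with `u` vertical and `x` horizontal. -/
def ClairautCondition (I' : ModelWithCorners ℝ E' H') (g : FormField I M) (φ : M → N)
    (G : M → ℝ) : Prop :=
  ∀ p : M, ∀ u ∈ modelVertical I I' φ p, ∀ x ∈ modelHorizontal I' g φ p,
    modelDeriv I 𝓘(ℝ, ℝ) G p (u + x) * modelForm g p u u
      + modelForm g p (modelT I' g φ p u u) x = 0

/-- The derivative of the square of `r sin θ` along a geodesic, for `r = e^G`. -/
lemma hasDerivAt_clairaut (hφ : IsRiemannianMap g g' φ) (hg : IsMetric g) (hg' : IsMetric g')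
    {G : M → ℝ} (hG : ContMDiff I 𝓘(ℝ, ℝ) ∞ G) {γ : ℝ → M} {J : Set ℝ} (hγ : IsGeodesicOn g γ J)
    (hJ : IsOpen J) {t : ℝ} (ht : t ∈ J) (hv : modelVelocity I γ t ≠ 0) {u x : E}
    (hu : u ∈ modelVertical I I' φ (γ t))
    (hx : x ∈ modelHorizontal I' g φ (γ t)) (hux : modelVelocity I γ t = u + x) :
    HasDerivAt (fun s => Real.exp (G (γ s)) ^ 2
        * (modelForm (vertForm g g' φ) (γ s) (modelVelocity I γ s) (modelVelocity I γ s)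
          / modelForm g (γ s) (modelVelocity I γ s) (modelVelocity I γ s)))
      (2 * Real.exp (G (γ t)) ^ 2 / modelForm g (γ t) (u + x) (u + x)
        * (modelDeriv I 𝓘(ℝ, ℝ) G (γ t) (u + x) * modelForm g (γ t) u u
          + modelForm g (γ t) (modelT I' g φ (γ t) u u) x)) t := by
  have hpos : 0 < modelForm g (γ t) (modelVelocity I γ t) (modelVelocity I γ t) := hg.pos _ _ hv
  have h1 := hγ.hasDerivAt_energy hJ hg ht
  have h2 := hγ.hasDerivAt_vertForm hJ hφ hg hg' ht hu hx hux
  have hγt : MDifferentiableAt 𝓘(ℝ, ℝ) I γ t :=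
    ((hγ.1 t ht).contMDiffAt (hJ.mem_nhds ht)).mdifferentiableAt (by simp)
  have hGt : MDifferentiableAt I 𝓘(ℝ, ℝ) G (γ t) := hG.contMDiffAt.mdifferentiableAt (by simp)
  have h3 : HasDerivAt (fun s => G (γ s)) (modelDeriv I 𝓘(ℝ, ℝ) G (γ t) (u + x)) t := by
    rw [← hux, modelVelocity, ← modelDeriv_comp hGt hγt, modelDeriv_eq_fderiv]
    exact (hGt.comp t hγt).differentiableAt.hasFDerivAt.hasDerivAt
  have hk : modelForm (vertForm g g' φ) (γ t) (modelVelocity I γ t) (modelVelocity I γ t)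
      = modelForm g (γ t) u u := by
    have h4 : modelVertProj I' g φ (γ t) (u + x) = u := by
      have hc := isCompl_vertical_horizontal hg I' φ (γ t)
      rw [modelVertProj_eq hg, map_add, Submodule.projectionOnto_apply_of_mem_left hc hu,
        Submodule.projectionOnto_apply_of_mem_right hc hx, add_zero]
    rw [hφ.modelForm_vertForm_self hg, hux, h4]
  refine ((h3.exp.pow 2).mul (h2.div h1 hpos.ne')).congr_deriv ?_
  simp only [Pi.pow_apply, Pi.div_apply, hk, Nat.cast_ofNat]
  rw [← hux]
  field_simp
  ring

/-- Clairaut's relation along all geodesics is equivalent to its infinitesimal form, because every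
tangent vector is the velocity of a geodesic. -/
theorem isClairaut_iff (hφ : IsRiemannianMap g g' φ) (hg : IsMetric g) (hg' : IsMetric g')
    {G : M → ℝ} (hG : ContMDiff I 𝓘(ℝ, ℝ) ∞ G) :
    IsClairaut g g' φ (fun p => Real.exp (G p)) ↔ ClairautCondition I' g φ G := by
  have hK : ∀ (p : M) (v : E), 0 ≤ modelForm (vertForm g g' φ) p v v / modelForm g p v v := by
    intro p v
    rw [hφ.modelForm_vertForm_self hg]
    exact div_nonneg (hg.modelForm_nonneg _ _) (hg.modelForm_nonneg _ _)
  constructor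
  · intro h p u hu x hx
    by_cases hu0 : u = 0
    · have h1 := hφ.modelForm_modelT hg hg' p hu hu hx
      rw [h1, hu0]
      simp [christoffelForm]
    obtain ⟨γ, ε, hε, hγ0, hγv, hγ⟩ := exists_isGeodesicOn hg p (u + x)
    subst hγ0
    have hJ : IsOpen (Ioo (-ε) ε) := isOpen_Ioo
    have h0 : (0 : ℝ) ∈ Ioo (-ε) ε := ⟨by linarith, hε⟩
    have hux : u + x ≠ 0 := by
      intro h0
      have h1 : modelForm g (γ 0) u (u + x) = 0 := by rw [h0, map_zero]
      have h2 : modelForm g (γ 0) u x = 0 := hx u hu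
      have h3 : 0 < modelForm g (γ 0) u u := hg.pos _ u hu0
      rw [map_add] at h1
      linarith
    obtain ⟨e, he⟩ := exists_eq_const_of_hasDerivAt_zero hJ ordConnected_Ioo
      fun t ht => hγ.hasDerivAt_energy hJ hg ht
    have hvel : ∀ t ∈ Ioo (-ε) ε, modelVelocity I γ t ≠ 0 := by
      intro t ht h0'
      have h1 := (he t ht).trans (he 0 h0).symm
      have h2 : 0 < modelForm g (γ 0) (modelVelocity I γ 0) (modelVelocity I γ 0) :=
        hg.pos _ _ (by rw [hγv]; exact hux)
      rw [h0', map_zero] at h1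
      linarith
    obtain ⟨c, hc⟩ := h.clairaut γ _ hJ ordConnected_Ioo hγ hvel
    have hd := hasDerivAt_clairaut hφ hg hg' hG hγ hJ h0 (hvel 0 h0) hu hx hγv
    have hd' := hd.congr_of_eventuallyEq (f₁ := fun _ => c ^ 2) (by
      filter_upwards [hJ.mem_nhds h0] with s hs
      have h1 := hφ.sin_horizontalAngle hg (γ s) (hvel s hs)
      have h2 : Real.exp (G (γ s)) * √(modelForm (vertForm g g' φ) (γ s) (modelVelocity I γ s)
          (modelVelocity I γ s) / modelForm g (γ s) (modelVelocity I γ s)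
          (modelVelocity I γ s)) = c := by rw [← h1]; exact hc s hs
      rw [← h2, mul_pow, Real.sq_sqrt (hK _ _)])
    have h3 := hd'.unique (hasDerivAt_const (0 : ℝ) (c ^ 2))
    have h4 : 0 < modelForm g (γ 0) (u + x) (u + x) := hg.pos _ _ hux
    rcases mul_eq_zero.1 h3 with h5 | h5
    · exact absurd h5 (by positivity)
    · exact h5
  · intro h
    refine ⟨hφ, fun p => Real.exp_pos _, fun γ J hJ hJ' hγ hvel => ?_⟩
    obtain ⟨c, hc⟩ := exists_eq_const_of_hasDerivAt_zero hJ hJ' fun t ht => by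
      have hd := hasDerivAt_clairaut hφ hg hg' hG hγ hJ ht (hvel t ht)
        (modelVertProj_mem hg (γ t) (modelVelocity I γ t))
        (sub_modelVertProj_mem hg (γ t) (modelVelocity I γ t)) (by abel)
      rwa [h _ _ (modelVertProj_mem hg (γ t) (modelVelocity I γ t)) _
        (sub_modelVertProj_mem hg (γ t) (modelVelocity I γ t)), mul_zero] at hd
    refine ⟨√c, fun t ht => ?_⟩
    have h1 := hφ.sin_horizontalAngle hg (γ t) (hvel t ht)
    rw [← hc t ht, Real.sqrt_mul (by positivity), Real.sqrt_sq (Real.exp_pos _).le]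
    exact congrArg (Real.exp (G (γ t)) * ·) h1

end Clairaut

/-! ### Warped products -/

section WarpedProduct

variable {E₁ : Type*} [NormedAddCommGroup E₁] [NormedSpace ℝ E₁]
  {H₁ : Type*} [TopologicalSpace H₁] {I₁ : ModelWithCorners ℝ E₁ H₁}
  {M₁ : Type*} [TopologicalSpace M₁] [ChartedSpace H₁ M₁]
  {E₂ : Type*} [NormedAddCommGroup E₂] [NormedSpace ℝ E₂]
  {H₂ : Type*} [TopologicalSpace H₂] {I₂ : ModelWithCorners ℝ E₂ H₂}
  {M₂ : Type*} [TopologicalSpace M₂] [ChartedSpace H₂ M₂]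
  {F₁ : Type*} [NormedAddCommGroup F₁] [NormedSpace ℝ F₁]
  {K₁ : Type*} [TopologicalSpace K₁] {L₁ : ModelWithCorners ℝ F₁ K₁}
  {N₁ : Type*} [TopologicalSpace N₁] [ChartedSpace K₁ N₁]
  {F₂ : Type*} [NormedAddCommGroup F₂] [NormedSpace ℝ F₂]
  {K₂ : Type*} [TopologicalSpace K₂] {L₂ : ModelWithCorners ℝ F₂ K₂}
  {N₂ : Type*} [TopologicalSpace N₂] [ChartedSpace K₂ N₂]
  {g₁ : FormField I₁ M₁} {f : M₁ → ℝ} {g₂ : FormField I₂ M₂}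
  {h₁ : FormField L₁ N₁} {ρ : N₁ → ℝ} {h₂ : FormField L₂ N₂}
  {φ₁ : M₁ → N₁} {φ₂ : M₂ → N₂}

lemma modelDeriv_fst (p : M₁ × M₂) :
    modelDeriv (I₁.prod I₂) I₁ (Prod.fst : M₁ × M₂ → M₁) p = .fst ℝ E₁ E₂ := mfderiv_fst

lemma modelDeriv_snd (p : M₁ × M₂) :
    modelDeriv (I₁.prod I₂) I₂ (Prod.snd : M₁ × M₂ → M₂) p = .snd ℝ E₁ E₂ := mfderiv_snd

lemma modelForm_warped (g₁ : FormField I₁ M₁) (f : M₁ → ℝ) (g₂ : FormField I₂ M₂) (p : M₁ × M₂)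
    (a b : E₁ × E₂) : modelForm (warped g₁ f g₂) p a b
      = modelForm g₁ p.1 a.1 b.1 + f p.1 ^ 2 * modelForm g₂ p.2 a.2 b.2 := by
  have h : modelForm (warped g₁ f g₂) p a b
      = modelForm g₁ p.1 (modelDeriv (I₁.prod I₂) I₁ (Prod.fst : M₁ × M₂ → M₁) p a)
          (modelDeriv (I₁.prod I₂) I₁ (Prod.fst : M₁ × M₂ → M₁) p b)
        + f p.1 ^ 2 * modelForm g₂ p.2 (modelDeriv (I₁.prod I₂) I₂ (Prod.snd : M₁ × M₂ → M₂) p a)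
          (modelDeriv (I₁.prod I₂) I₂ (Prod.snd : M₁ × M₂ → M₂) p b) := rfl
  rw [h, modelDeriv_fst, modelDeriv_snd]
  rfl

lemma modelDeriv_prodMap {p : M₁ × M₂} (h1 : MDifferentiableAt I₁ L₁ φ₁ p.1)
    (h2 : MDifferentiableAt I₂ L₂ φ₂ p.2) (u : E₁ × E₂) :
    modelDeriv (I₁.prod I₂) (L₁.prod L₂) (Prod.map φ₁ φ₂) p u
      = (modelDeriv I₁ L₁ φ₁ p.1 u.1, modelDeriv I₂ L₂ φ₂ p.2 u.2) :=
  congrArg (fun L : E₁ × E₂ →L[ℝ] F₁ × F₂ => L u) (mfderiv_prodMap h1 h2)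

lemma mem_modelVertical_prodMap {p : M₁ × M₂} (h1 : MDifferentiableAt I₁ L₁ φ₁ p.1)
    (h2 : MDifferentiableAt I₂ L₂ φ₂ p.2) {u : E₁ × E₂} :
    u ∈ modelVertical (I₁.prod I₂) (L₁.prod L₂) (Prod.map φ₁ φ₂) p
      ↔ u.1 ∈ modelVertical I₁ L₁ φ₁ p.1 ∧ u.2 ∈ modelVertical I₂ L₂ φ₂ p.2 := by
  rw [mem_modelVertical, modelDeriv_prodMap h1 h2, mem_modelVertical, mem_modelVertical,
    Prod.mk_eq_zero]

lemma mem_modelHorizontal_prodMap (hf0 : ∀ p, 0 < f p) {p : M₁ × M₂}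
    (h1 : MDifferentiableAt I₁ L₁ φ₁ p.1)
    (h2 : MDifferentiableAt I₂ L₂ φ₂ p.2) {x : E₁ × E₂} :
    x ∈ modelHorizontal (L₁.prod L₂) (warped g₁ f g₂) (Prod.map φ₁ φ₂) p
      ↔ x.1 ∈ modelHorizontal L₁ g₁ φ₁ p.1 ∧ x.2 ∈ modelHorizontal L₂ g₂ φ₂ p.2 := by
  have hf := hf0 p.1
  simp only [mem_modelHorizontal]
  constructor
  · intro h
    constructor
    · intro u hu
      have := h (u, 0) ((mem_modelVertical_prodMap h1 h2).2 ⟨hu, Submodule.zero_mem _⟩)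
      simpa [modelForm_warped] using this
    · intro u hu
      have := h (0, u) ((mem_modelVertical_prodMap h1 h2).2 ⟨Submodule.zero_mem _, hu⟩)
      simpa [modelForm_warped, hf.ne'] using this
  · rintro ⟨ha, hb⟩ u hu
    rw [mem_modelVertical_prodMap h1 h2] at hu
    rw [modelForm_warped, ha _ hu.1, hb _ hu.2, mul_zero, add_zero]

/-- For a Riemannian warped product map the warping functions correspond: comparing the two metrics
on a horizontal vector of the second factor gives `ρ ∘ φ₁ = f`. -/
lemma IsRiemannianWarpedProductMap.comp_eq [FiniteDimensional ℝ E₂] [Nonempty M₂]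
    (hφ : IsRiemannianWarpedProductMap g₁ f g₂ h₁ ρ h₂ φ₁ φ₂) (hg₂ : IsMetric g₂)
    (hf0 : ∀ p, 0 < f p) (hρ0 : ∀ q, 0 < ρ q) (p₁ : M₁) : ρ (φ₁ p₁) = f p₁ := by
  obtain ⟨p₂⟩ := ‹Nonempty M₂›
  have h1 : MDifferentiableAt I₁ L₁ φ₁ p₁ := hφ.fst.smooth.contMDiffAt.mdifferentiableAt (by simp)
  have h2 : MDifferentiableAt I₂ L₂ φ₂ p₂ := hφ.snd.smooth.contMDiffAt.mdifferentiableAt (by simp)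
  obtain ⟨w, hw⟩ : ∃ w : E₂, modelDeriv I₂ L₂ φ₂ p₂ w ≠ 0 := by
    by_contra h
    push Not at h
    exact hφ.snd.rank_pos p₂ (ContinuousLinearMap.ext h)
  set x := w - modelVertProj L₂ g₂ φ₂ p₂ w with hx
  have hxh : x ∈ modelHorizontal L₂ g₂ φ₂ p₂ := sub_modelVertProj_mem hg₂ p₂ w
  have hx0 : x ≠ 0 := by
    intro h0
    refine hw ?_
    rw [sub_eq_zero.1 h0]
    exact modelVertProj_mem hg₂ p₂ w
  have hmem : ((0, x) : E₁ × E₂)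
      ∈ modelHorizontal (L₁.prod L₂) (warped g₁ f g₂) (Prod.map φ₁ φ₂) (p₁, p₂) :=
    (mem_modelHorizontal_prodMap hf0 h1 h2).2 ⟨Submodule.zero_mem _, hxh⟩
  have hiso : modelForm (warped h₁ ρ h₂) (φ₁ p₁, φ₂ p₂)
      (modelDeriv (I₁.prod I₂) (L₁.prod L₂) (Prod.map φ₁ φ₂) (p₁, p₂) (0, x))
      (modelDeriv (I₁.prod I₂) (L₁.prod L₂) (Prod.map φ₁ φ₂) (p₁, p₂) (0, x))
      = modelForm (warped g₁ f g₂) (p₁, p₂) (0, x) (0, x) :=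
    hφ.prod.isometric (p₁, p₂) _ hmem _ hmem
  have hiso2 : modelForm h₂ (φ₂ p₂) (modelDeriv I₂ L₂ φ₂ p₂ x) (modelDeriv I₂ L₂ φ₂ p₂ x)
      = modelForm g₂ p₂ x x := hφ.snd.isometric p₂ _ hxh _ hxh
  have hpos : 0 < modelForm g₂ p₂ x x := hg₂.pos _ _ hx0
  rw [modelDeriv_prodMap (p := (p₁, p₂)) h1 h2, modelForm_warped, modelForm_warped] at hiso
  simp only [map_zero, zero_add, hiso2] at hiso
  have h3 := mul_right_cancel₀ hpos.ne' hiso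
  exact (pow_left_inj₀ (hρ0 _).le (hf0 _).le two_ne_zero).1 h3

lemma modelDeriv_eq_zero_of_comp {f : M₁ → ℝ} {ρ : N₁ → ℝ} {p₁ : M₁}
    (hf : ∀ p, ρ (φ₁ p) = f p) (hρ : MDifferentiableAt L₁ 𝓘(ℝ, ℝ) ρ (φ₁ p₁))
    (h1 : MDifferentiableAt I₁ L₁ φ₁ p₁) {u : E₁} (hu : u ∈ modelVertical I₁ L₁ φ₁ p₁) :
    modelDeriv I₁ 𝓘(ℝ, ℝ) f p₁ u = 0 := by
  rw [← funext hf, modelDeriv_comp hρ h1, mem_modelVertical.1 hu, map_zero]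

lemma vertForm_warped (hf : ∀ p, ρ (φ₁ p) = f p) (h1 : MDifferentiable I₁ L₁ φ₁)
    (h2 : MDifferentiable I₂ L₂ φ₂) :
    vertForm (warped g₁ f g₂) (warped h₁ ρ h₂) (Prod.map φ₁ φ₂)
      = warped (vertForm g₁ h₁ φ₁) f (vertForm g₂ h₂ φ₂) := by
  funext p
  refine LinearMap.ext fun a => LinearMap.ext fun b => ?_
  have key : ∀ a b : E₁ × E₂,
      modelForm (vertForm (warped g₁ f g₂) (warped h₁ ρ h₂) (Prod.map φ₁ φ₂)) p a b
        = modelForm (warped (vertForm g₁ h₁ φ₁) f (vertForm g₂ h₂ φ₂)) p a b := by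
    intro a b
    simp only [modelForm_warped, modelForm_vertForm_eq, modelDeriv_prodMap (h1 p.1) (h2 p.2),
      Prod.map_fst, Prod.map_snd, hf]
    ring
  exact key a b

section Charts

variable [I₁.Boundaryless] [IsManifold I₁ ∞ M₁] [I₂.Boundaryless] [IsManifold I₂ ∞ M₂]

lemma modelDeriv_extChartAt_symm_prod {x₀ : M₁ × M₂} {y : E₁ × E₂}
    (hy : y ∈ (extChartAt (I₁.prod I₂) x₀).target) (u : E₁ × E₂) :
    modelDeriv 𝓘(ℝ, E₁ × E₂) (I₁.prod I₂) (extChartAt (I₁.prod I₂) x₀).symm y u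
      = (modelDeriv 𝓘(ℝ, E₁) I₁ (extChartAt I₁ x₀.1).symm y.1 u.1,
          modelDeriv 𝓘(ℝ, E₂) I₂ (extChartAt I₂ x₀.2).symm y.2 u.2) := by
  have hs := mdifferentiableAt_extChartAt_symm (I := I₁.prod I₂) hy
  have hy' := hy
  rw [extChartAt_prod, PartialEquiv.prod_target] at hy'
  refine Prod.ext ?_ ?_
  · have h1 := modelDeriv_comp (G := (Prod.fst : M₁ × M₂ → M₁)) (I'' := I₁)
      mdifferentiableAt_fst hs u
    rw [modelDeriv_fst] at h1
    refine Eq.trans h1.symm ?_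
    have h2 := modelDeriv_comp (F := (Prod.fst : E₁ × E₂ → E₁)) (I := 𝓘(ℝ, E₁ × E₂))
      (mdifferentiableAt_extChartAt_symm (I := I₁) hy'.1)
      (differentiableAt_fst.mdifferentiableAt) u
    rw [modelDeriv_eq_fderiv, fderiv_fst] at h2
    rw [extChartAt_prod]
    exact h2
  · have h1 := modelDeriv_comp (G := (Prod.snd : M₁ × M₂ → M₂)) (I'' := I₂)
      mdifferentiableAt_snd hs u
    rw [modelDeriv_snd] at h1
    refine Eq.trans h1.symm ?_
    have h2 := modelDeriv_comp (F := (Prod.snd : E₁ × E₂ → E₂)) (I := 𝓘(ℝ, E₁ × E₂))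
      (mdifferentiableAt_extChartAt_symm (I := I₂) hy'.2)
      (differentiableAt_snd.mdifferentiableAt) u
    rw [modelDeriv_eq_fderiv, fderiv_snd] at h2
    rw [extChartAt_prod]
    exact h2

lemma chartMetric_warped {x₀ : M₁ × M₂} {y : E₁ × E₂}
    (hy : y ∈ (extChartAt (I₁.prod I₂) x₀).target) (u v : E₁ × E₂) :
    chartMetric (warped g₁ f g₂) x₀ y u v = chartMetric g₁ x₀.1 y.1 u.1 v.1
      + f ((extChartAt I₁ x₀.1).symm y.1) ^ 2 * chartMetric g₂ x₀.2 y.2 u.2 v.2 := by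
  rw [chartMetric_eq, modelDeriv_extChartAt_symm_prod hy, modelDeriv_extChartAt_symm_prod hy,
    modelForm_warped, chartMetric_eq, chartMetric_eq, extChartAt_prod]
  rfl

variable [FiniteDimensional ℝ E₁] [FiniteDimensional ℝ E₂]

lemma IsSmoothForm.warped (hg₁ : IsSmoothForm g₁) (hf : ContMDiff I₁ 𝓘(ℝ, ℝ) ∞ f)
    (hg₂ : IsSmoothForm g₂) : IsSmoothForm (warped g₁ f g₂) := by
  refine isSmoothForm_of_apply fun x₀ u v y hy => ContDiffAt.contDiffWithinAt ?_
  have hy' := hy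
  rw [extChartAt_prod, PartialEquiv.prod_target] at hy'
  have hev : (fun z => chartMetric (ClairautWarped.warped g₁ f g₂) x₀ z u v) =ᶠ[𝓝 y]
      fun z => chartForm g₁ x₀.1 z.1 u.1 v.1
        + f ((extChartAt I₁ x₀.1).symm z.1) ^ 2 * chartForm g₂ x₀.2 z.2 u.2 v.2 :=
    Filter.eventually_of_mem ((isOpen_extChartAt_target x₀).mem_nhds hy)
      fun z hz => chartMetric_warped hz u v
  refine ContDiffAt.congr_of_eventuallyEq ?_ hev
  have h1 : ContDiffAt ℝ ∞ (fun z : E₁ × E₂ => chartForm g₁ x₀.1 z.1) y :=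
    ContDiffAt.comp y (g := chartForm g₁ x₀.1) (hg₁.contDiffAt hy'.1) contDiffAt_fst
  have h2 : ContDiffAt ℝ ∞ (fun z : E₁ × E₂ => chartForm g₂ x₀.2 z.2) y :=
    ContDiffAt.comp y (g := chartForm g₂ x₀.2) (hg₂.contDiffAt hy'.2) contDiffAt_snd
  have h3 : ContDiffAt ℝ ∞ (fun z : E₁ × E₂ => f ((extChartAt I₁ x₀.1).symm z.1)) y :=
    ContDiffAt.comp y (g := fun z => f ((extChartAt I₁ x₀.1).symm z))
      (hf.contMDiffAt.comp y.1 (contMDiffAt_extChartAt_symm hy'.1)).contDiffAt contDiffAt_fst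
  exact ((h1.clm_apply contDiffAt_const).clm_apply contDiffAt_const).add
    ((h3.pow 2).mul ((h2.clm_apply contDiffAt_const).clm_apply contDiffAt_const))

lemma IsMetric.warped (hg₁ : IsMetric g₁) (hf : ContMDiff I₁ 𝓘(ℝ, ℝ) ∞ f) (hf0 : ∀ p, 0 < f p)
    (hg₂ : IsMetric g₂) : IsMetric (warped g₁ f g₂) where
  symm p u v := by
    have key : ∀ u v : E₁ × E₂, modelForm (ClairautWarped.warped g₁ f g₂) p u v
        = modelForm (ClairautWarped.warped g₁ f g₂) p v u := by
      intro u v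
      rw [modelForm_warped, modelForm_warped, hg₁.modelForm_symm, hg₂.modelForm_symm]
    exact key u v
  pos p u hu := by
    have key : ∀ u : E₁ × E₂, u ≠ 0 → 0 < modelForm (ClairautWarped.warped g₁ f g₂) p u u := by
      intro u hu
      rw [modelForm_warped]
      have hfp := hf0 p.1
      have h1 := hg₁.modelForm_nonneg p.1 u.1
      have h2 := hg₂.modelForm_nonneg p.2 u.2
      by_cases h : u.1 = 0
      · have h3 : u.2 ≠ 0 := fun h' => hu (Prod.ext h h')
        have h4 : 0 < modelForm g₂ p.2 u.2 u.2 := hg₂.pos _ _ h3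
        positivity
      · have h4 : 0 < modelForm g₁ p.1 u.1 u.1 := hg₁.pos _ _ h
        positivity
    exact key u hu
  smooth := hg₁.smooth.warped hf hg₂.smooth

/-- The Christoffel symbols of a warped sum of two fields of forms, when the last vector is in the
radical of the second form. -/
lemma christoffelForm_warped (hg₁ : IsSmoothForm g₁) (hf : ContMDiff I₁ 𝓘(ℝ, ℝ) ∞ f)
    (hg₂ : IsSmoothForm g₂) (p : M₁ × M₂) (u v : E₁ × E₂) {x : E₁ × E₂}
    (hx : ∀ w, modelForm g₂ p.2 w x.2 = 0) :
    christoffelForm (chartForm (warped g₁ f g₂) p) (extChartAt (I₁.prod I₂) p p) u v x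
      = christoffelForm (chartForm g₁ p.1) (extChartAt I₁ p.1 p.1) u.1 v.1 x.1
        + f p.1 ^ 2 * christoffelForm (chartForm g₂ p.2) (extChartAt I₂ p.2 p.2) u.2 v.2 x.2
        - f p.1 * modelDeriv I₁ 𝓘(ℝ, ℝ) f p.1 x.1 * modelForm g₂ p.2 u.2 v.2 := by
  have hy := mem_extChartAt_target (I := I₁.prod I₂) p
  have hy1 := mem_extChartAt_target (I := I₁) p.1
  have hy2 := mem_extChartAt_target (I := I₂) p.2
  have hyeq : extChartAt (I₁.prod I₂) p p = (extChartAt I₁ p.1 p.1, extChartAt I₂ p.2 p.2) := by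
    rw [extChartAt_prod]; rfl
  have hd := (hg₁.warped hf hg₂).differentiableAt hy
  have hd1 := hg₁.differentiableAt hy1
  have hd2 := hg₂.differentiableAt hy2
  have hfd : HasFDerivAt (fun z => f ((extChartAt I₁ p.1).symm z))
      (modelDeriv I₁ 𝓘(ℝ, ℝ) f p.1) (extChartAt I₁ p.1 p.1) := by
    have h1 : MDifferentiableAt I₁ 𝓘(ℝ, ℝ) f
      ((extChartAt I₁ p.1).symm (extChartAt I₁ p.1 p.1)) :=
      hf.contMDiffAt.mdifferentiableAt (by simp)
    have h2 := mdifferentiableAt_extChartAt_symm (I := I₁) hy1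
    have h3 : DifferentiableAt ℝ (fun z => f ((extChartAt I₁ p.1).symm z))
      (extChartAt I₁ p.1 p.1) := (h1.comp _ h2).differentiableAt
    have h4 : fderiv ℝ (fun z => f ((extChartAt I₁ p.1).symm z)) (extChartAt I₁ p.1 p.1)
        = modelDeriv I₁ 𝓘(ℝ, ℝ) f p.1 := by
      refine ContinuousLinearMap.ext fun w => ?_
      rw [← modelDeriv_eq_fderiv, modelDeriv_comp h1 h2, modelDeriv_extChartAt_symm_self,
        extChartAt_to_inv]
      rfl
    rw [← h4]
    exact h3.hasFDerivAt
  have key : ∀ w a b : E₁ × E₂,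
      fderiv ℝ (chartForm (ClairautWarped.warped g₁ f g₂) p) (extChartAt (I₁.prod I₂) p p) w a b
        = fderiv ℝ (chartForm g₁ p.1) (extChartAt I₁ p.1 p.1) w.1 a.1 b.1
          + (2 * f p.1 * modelDeriv I₁ 𝓘(ℝ, ℝ) f p.1 w.1 * modelForm g₂ p.2 a.2 b.2
            + f p.1 ^ 2 * fderiv ℝ (chartForm g₂ p.2) (extChartAt I₂ p.2 p.2) w.2 a.2 b.2) := by
    intro w a b
    have hev : (fun z => chartForm (ClairautWarped.warped g₁ f g₂) p z a b)
        =ᶠ[𝓝 (extChartAt (I₁.prod I₂) p p)] fun z => chartForm g₁ p.1 z.1 a.1 b.1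
          + f ((extChartAt I₁ p.1).symm z.1) ^ 2 * chartForm g₂ p.2 z.2 a.2 b.2 :=
      Filter.eventually_of_mem ((isOpen_extChartAt_target p).mem_nhds hy)
        fun z hz => chartMetric_warped hz a b
    have hA : HasFDerivAt (fun z => chartForm g₁ p.1 z a.1 b.1)
        (fderiv ℝ (fun z => chartForm g₁ p.1 z a.1 b.1) (extChartAt I₁ p.1 p.1))
        (extChartAt I₁ p.1 p.1) :=
      DifferentiableAt.hasFDerivAt (by fun_prop)
    have hB : HasFDerivAt (fun z => chartForm g₂ p.2 z a.2 b.2)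
        (fderiv ℝ (fun z => chartForm g₂ p.2 z a.2 b.2) (extChartAt I₂ p.2 p.2))
        (extChartAt I₂ p.2 p.2) :=
      DifferentiableAt.hasFDerivAt (by fun_prop)
    have e1 : HasFDerivAt (fun z : E₁ × E₂ => chartForm g₁ p.1 z.1 a.1 b.1) _
        (extChartAt I₁ p.1 p.1, extChartAt I₂ p.2 p.2) :=
      HasFDerivAt.comp (g := fun z => chartForm g₁ p.1 z a.1 b.1) _ hA hasFDerivAt_fst
    have e2 : HasFDerivAt (fun z : E₁ × E₂ => chartForm g₂ p.2 z.2 a.2 b.2) _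
        (extChartAt I₁ p.1 p.1, extChartAt I₂ p.2 p.2) :=
      HasFDerivAt.comp (g := fun z => chartForm g₂ p.2 z a.2 b.2) _ hB hasFDerivAt_snd
    have e3 : HasFDerivAt (fun z : E₁ × E₂ => f ((extChartAt I₁ p.1).symm z.1)) _
        (extChartAt I₁ p.1 p.1, extChartAt I₂ p.2 p.2) :=
      HasFDerivAt.comp (g := fun z => f ((extChartAt I₁ p.1).symm z)) _ hfd hasFDerivAt_fst
    have e4 : HasFDerivAt (fun z : E₁ × E₂ => chartForm g₁ p.1 z.1 a.1 b.1
          + f ((extChartAt I₁ p.1).symm z.1) ^ 2 * chartForm g₂ p.2 z.2 a.2 b.2) _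
        (extChartAt I₁ p.1 p.1, extChartAt I₂ p.2 p.2) := e1.add ((e3.pow 2).mul e2)
    rw [← fderiv_form_apply hd, hev.fderiv_eq, hyeq, e4.fderiv,
      ← fderiv_form_apply hd1, ← fderiv_form_apply hd2]
    simp only [extChartAt_to_inv, add_apply, smul_apply, ContinuousLinearMap.comp_apply,
      ContinuousLinearMap.coe_fst', ContinuousLinearMap.coe_snd', smul_eq_mul, chartForm_apply,
      chartMetric_self]
    ring
  simp only [christoffelForm, key, hx]
  ring

variable [FiniteDimensional ℝ F₁] [FiniteDimensional ℝ F₂] [L₁.Boundaryless] [L₂.Boundaryless]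
  [IsManifold L₁ ∞ N₁] [IsManifold L₂ ∞ N₂]

/-- The second fundamental form of the fibres of a Riemannian warped product map. -/
lemma IsRiemannianWarpedProductMap.modelForm_modelT [Nonempty M₂]
    (hφ : IsRiemannianWarpedProductMap g₁ f g₂ h₁ ρ h₂ φ₁ φ₂) (hg₁ : IsMetric g₁)
    (hg₂ : IsMetric g₂) (hh₁ : IsMetric h₁) (hh₂ : IsMetric h₂)
    (hf : ContMDiff I₁ 𝓘(ℝ, ℝ) ∞ f) (hf0 : ∀ p, 0 < f p)
    (hρ : ContMDiff L₁ 𝓘(ℝ, ℝ) ∞ ρ) (hρ0 : ∀ q, 0 < ρ q) (p : M₁ × M₂) {u v x : E₁ × E₂}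
    (hu1 : u.1 ∈ modelVertical I₁ L₁ φ₁ p.1) (hu2 : u.2 ∈ modelVertical I₂ L₂ φ₂ p.2)
    (hv1 : v.1 ∈ modelVertical I₁ L₁ φ₁ p.1) (hv2 : v.2 ∈ modelVertical I₂ L₂ φ₂ p.2)
    (hx1 : x.1 ∈ modelHorizontal L₁ g₁ φ₁ p.1) (hx2 : x.2 ∈ modelHorizontal L₂ g₂ φ₂ p.2) :
    modelForm (ClairautWarped.warped g₁ f g₂) p
        (modelT (L₁.prod L₂) (ClairautWarped.warped g₁ f g₂) (Prod.map φ₁ φ₂) p u v) x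
      = modelForm g₁ p.1 (modelT L₁ g₁ φ₁ p.1 u.1 v.1) x.1
        + f p.1 ^ 2 * modelForm g₂ p.2 (modelT L₂ g₂ φ₂ p.2 u.2 v.2) x.2
        - f p.1 * modelDeriv I₁ 𝓘(ℝ, ℝ) f p.1 x.1 * modelForm g₂ p.2 u.2 v.2 := by
  have hd1 : MDifferentiable I₁ L₁ φ₁ := hφ.fst.smooth.mdifferentiable (by simp)
  have hd2 : MDifferentiable I₂ L₂ φ₂ := hφ.snd.smooth.mdifferentiable (by simp)
  have hvf2 := hφ.snd.isVerticalForm hg₂ hh₂ p.2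
  have hk2 := hvf2.hor x.2 hx2
  have hk2' := hvf2.ver u.2 hu2 v.2
  simp only [chartForm_apply, chartMetric_self] at hk2 hk2'
  have hs : ∀ w, modelForm (vertForm g₂ h₂ φ₂) p.2 w x.2 = 0 := by
    intro w
    rw [← hk2 w, modelForm_vertForm_eq, modelForm_vertForm_eq, hg₂.modelForm_symm,
      hh₂.modelForm_symm]
  rw [hφ.prod.modelForm_modelT (hg₁.warped hf hf0 hg₂) (hh₁.warped hρ hρ0 hh₂) p
      ((mem_modelVertical_prodMap (hd1 _) (hd2 _)).2 ⟨hu1, hu2⟩)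
      ((mem_modelVertical_prodMap (hd1 _) (hd2 _)).2 ⟨hv1, hv2⟩)
      ((mem_modelHorizontal_prodMap hf0 (hd1 _) (hd2 _)).2 ⟨hx1, hx2⟩),
    vertForm_warped (hφ.comp_eq hg₂ hf0 hρ0) hd1 hd2,
    christoffelForm_warped (hg₁.smooth.vertForm hh₁.smooth hφ.fst.smooth) hf
      (hg₂.smooth.vertForm hh₂.smooth hφ.snd.smooth) p u v hs,
    hφ.fst.modelForm_modelT hg₁ hh₁ p.1 hu1 hv1 hx1,
    hφ.snd.modelForm_modelT hg₂ hh₂ p.2 hu2 hv2 hx2, hk2']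

end Charts

end WarpedProduct

/-! ### Umbilicity and mean curvature -/

section Umbilic

variable {E : Type*} [NormedAddCommGroup E] [NormedSpace ℝ E]
  {H : Type*} [TopologicalSpace H] {I : ModelWithCorners ℝ E H}
  {M : Type*} [TopologicalSpace M] [ChartedSpace H M]
  {E' : Type*} [NormedAddCommGroup E'] [NormedSpace ℝ E']
  {H' : Type*} [TopologicalSpace H'] {I' : ModelWithCorners ℝ E' H'}
  {N : Type*} [TopologicalSpace N] [ChartedSpace H' N]
  {g : FormField I M} {g' : FormField I' N} {φ : M → N}

lemma IsMetric.eq_of_forall_modelForm_eq [FiniteDimensional ℝ E] (hg : IsMetric g) {p : M}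
    {W : Submodule ℝ E} {a b : E} (ha : a ∈ W) (hb : b ∈ W)
    (h : ∀ x ∈ W, modelForm g p a x = modelForm g p b x) : a = b := by
  by_contra hab
  have h1 : 0 < modelForm g p (a - b) (a - b) := hg.pos p _ (sub_ne_zero.2 hab)
  rw [map_sub (modelForm g p) a b, LinearMap.sub_apply, h _ (W.sub_mem ha hb), sub_self] at h1
  exact h1.false

/-- The gradient of `h` at `p`, as a vector of the model space. -/
def modelGradient (g : FormField I M) (h : M → ℝ) (p : M) : E := gradient g h p

lemma IsMetric.modelForm_modelGradient [FiniteDimensional ℝ E] (hg : IsMetric g) (h : M → ℝ)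
    (p : M) (w : E) :
    modelForm g p (modelGradient g h p) w = modelDeriv I 𝓘(ℝ, ℝ) h p w :=
  modelForm_gradient hg.pos h p w

lemma modelDeriv_log {F : M → ℝ} {p : M} (hF : MDifferentiableAt I 𝓘(ℝ, ℝ) F p) (h0 : F p ≠ 0)
    (w : E) : modelDeriv I 𝓘(ℝ, ℝ) (fun q => Real.log (F q)) p w
      = modelDeriv I 𝓘(ℝ, ℝ) F p w / F p := by
  rw [modelDeriv_comp (G := Real.log) (Real.differentiableAt_log h0).mdifferentiableAt hF,
    modelDeriv_eq_fderiv, (Real.hasDerivAt_log h0).hasFDerivAt.fderiv]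
  simp [div_eq_mul_inv]

lemma exists_orthonormal_span [FiniteDimensional ℝ E] (hg : IsMetric g) (p : M)
    (V : Submodule ℝ E) : ∃ (k : ℕ) (e : Fin k → E),
      (∀ i j, modelForm g p (e i) (e j) = if i = j then 1 else 0) ∧
        Submodule.span ℝ (range e) = V := by
  obtain ⟨b, hb⟩ := LinearMap.BilinForm.exists_orthogonal_basis
    (B := (modelForm g p).restrict V) ⟨fun u v => hg.modelForm_symm p (u : E) (v : E)⟩
  rw [LinearMap.isOrthoᵢ_def] at hb
  have hpos : ∀ i, 0 < modelForm g p (b i : E) (b i : E) := fun i =>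
    hg.pos p _ fun h => b.ne_zero i (Subtype.ext h)
  let w : Fin (finrank ℝ V) → ℝ := fun i => (√(modelForm g p (b i : E) (b i : E)))⁻¹
  have hw : ∀ i, IsUnit (w i) := fun i =>
    (inv_ne_zero (Real.sqrt_ne_zero'.2 (hpos i))).isUnit
  refine ⟨_, fun i => ((b.isUnitSMul hw i : V) : E), fun i j => ?_, ?_⟩
  · simp only [Basis.isUnitSMul_apply, Submodule.coe_smul, map_smul, LinearMap.smul_apply,
      smul_eq_mul]
    split_ifs with h
    · subst h
      have h1 := Real.mul_self_sqrt (hpos i).le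
      have h2 := Real.sqrt_ne_zero'.2 (hpos i)
      simp only [w]
      field_simp
      linarith
    · have h1 : modelForm g p (b i : E) (b j : E) = 0 := hb i j h
      rw [h1, mul_zero, mul_zero]
  · have h1 : (range fun i => ((b.isUnitSMul hw i : V) : E))
        = V.subtype '' range (b.isUnitSMul hw) := by
      rw [← range_comp]; rfl
    rw [h1, ← Submodule.map_span, Basis.span_eq, Submodule.map_top, Submodule.range_subtype]

/-- If `T_u v = g(u, v) X` and the fibres have positive dimension, then `X` is the mean curvature
vector field. -/
lemma isMeanCurvatureField_of_umbilic {X : ∀ p : M, TangentSpace I p}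
    (hV : ∀ p, modelVertical I I' φ p ≠ ⊥)
    (h : ∀ p : M, ∀ u ∈ vertical I I' φ p, ∀ v ∈ vertical I I' φ p,
      oneillT I' g φ p u v = g p u v • X p) : IsMeanCurvatureField I' g φ X := by
  intro p k e he hspan
  have hk : k ≠ 0 := by
    rintro rfl
    refine hV p ?_
    rw [range_eq_empty, Submodule.span_empty] at hspan
    exact hspan.symm
  have h1 : ∀ i, oneillT I' g φ p (e i) (e i) = X p := by
    intro i
    have hi : e i ∈ vertical I I' φ p := hspan ▸ Submodule.subset_span (mem_range_self i)
    rw [h p _ hi _ hi, he i i, if_pos rfl, one_smul]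
  simp only [h1, Finset.sum_const, Finset.card_univ, Fintype.card_fin]
  rw [← Nat.cast_smul_eq_nsmul ℝ, inv_smul_smul₀ (Nat.cast_ne_zero.2 hk)]

variable [FiniteDimensional ℝ E] [I.Boundaryless] [IsManifold I ∞ M]
  [FiniteDimensional ℝ E'] [I'.Boundaryless] [IsManifold I' ∞ N]

lemma IsRiemannianMap.modelForm_modelT_zero (hφ : IsRiemannianMap g g' φ) (hg : IsMetric g)
    (hg' : IsMetric g') (p : M) {x : E} (hx : x ∈ modelHorizontal I' g φ p) :
    modelForm g p (modelT I' g φ p 0 0) x = 0 := by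
  rw [hφ.modelForm_modelT hg hg' p (Submodule.zero_mem _) (Submodule.zero_mem _) hx]
  simp [christoffelForm]

/-- Polarisation for the second fundamental form of the fibres. -/
lemma IsRiemannianMap.modelForm_modelT_of_diag (hφ : IsRiemannianMap g g' φ) (hg : IsMetric g)
    (hg' : IsMetric g') (p : M) {x : E} (hx : x ∈ modelHorizontal I' g φ p) {c : ℝ}
    (h : ∀ u ∈ modelVertical I I' φ p,
      modelForm g p (modelT I' g φ p u u) x = c * modelForm g p u u) {u v : E}
    (hu : u ∈ modelVertical I I' φ p) (hv : v ∈ modelVertical I I' φ p) :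
    modelForm g p (modelT I' g φ p u v) x = c * modelForm g p u v := by
  have hvf := hφ.isVerticalForm hg hg' p
  have h1 := h u hu
  have h2 := h v hv
  have h3 := h (u + v) (Submodule.add_mem _ hu hv)
  rw [hφ.modelForm_modelT hg hg' p hu hu hx] at h1
  rw [hφ.modelForm_modelT hg hg' p hv hv hx] at h2
  rw [hφ.modelForm_modelT hg hg' p (Submodule.add_mem _ hu hv) (Submodule.add_mem _ hu hv) hx] at h3
  rw [hφ.modelForm_modelT hg hg' p hu hv hx]
  have h4 := fderiv_form_symm hvf.diff_k hvf.symm_k x u v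
  have h5 := hg.modelForm_symm p u v
  simp only [christoffelForm, map_add, add_apply, LinearMap.add_apply] at *
  linear_combination (h3 - h1 - h2) / 2 - h4 / 4 - c / 2 * h5

end Umbilic

/-! ### Clairaut's relation for warped product maps -/

section WarpedClairaut

variable {E₁ : Type*} [NormedAddCommGroup E₁] [NormedSpace ℝ E₁] [FiniteDimensional ℝ E₁]
  {H₁ : Type*} [TopologicalSpace H₁] {I₁ : ModelWithCorners ℝ E₁ H₁} [I₁.Boundaryless]
  {M₁ : Type*} [TopologicalSpace M₁] [ChartedSpace H₁ M₁] [IsManifold I₁ ∞ M₁]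
  {E₂ : Type*} [NormedAddCommGroup E₂] [NormedSpace ℝ E₂] [FiniteDimensional ℝ E₂]
  {H₂ : Type*} [TopologicalSpace H₂] {I₂ : ModelWithCorners ℝ E₂ H₂} [I₂.Boundaryless]
  {M₂ : Type*} [TopologicalSpace M₂] [ChartedSpace H₂ M₂] [IsManifold I₂ ∞ M₂]
  {F₁ : Type*} [NormedAddCommGroup F₁] [NormedSpace ℝ F₁] [FiniteDimensional ℝ F₁]
  {K₁ : Type*} [TopologicalSpace K₁] {L₁ : ModelWithCorners ℝ F₁ K₁} [L₁.Boundaryless]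
  {N₁ : Type*} [TopologicalSpace N₁] [ChartedSpace K₁ N₁] [IsManifold L₁ ∞ N₁]
  {F₂ : Type*} [NormedAddCommGroup F₂] [NormedSpace ℝ F₂] [FiniteDimensional ℝ F₂]
  {K₂ : Type*} [TopologicalSpace K₂] {L₂ : ModelWithCorners ℝ F₂ K₂} [L₂.Boundaryless]
  {N₂ : Type*} [TopologicalSpace N₂] [ChartedSpace K₂ N₂] [IsManifold L₂ ∞ N₂]

/-- A Riemannian warped product map between warped products of smooth Riemannian metrics with
smooth positive warping functions, whose factors have fibres of positive dimension. -/
structure WarpedSetup (g₁ : FormField I₁ M₁) (f : M₁ → ℝ) (g₂ : FormField I₂ M₂)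
    (h₁ : FormField L₁ N₁) (ρ : N₁ → ℝ) (h₂ : FormField L₂ N₂) (φ₁ : M₁ → N₁) (φ₂ : M₂ → N₂) :
    Prop where
  map : IsRiemannianWarpedProductMap g₁ f g₂ h₁ ρ h₂ φ₁ φ₂
  metric₁ : IsMetric g₁
  metric₂ : IsMetric g₂
  metric₁' : IsMetric h₁
  metric₂' : IsMetric h₂
  smooth_f : ContMDiff I₁ 𝓘(ℝ, ℝ) ∞ f
  f_pos : ∀ p, 0 < f p
  smooth_ρ : ContMDiff L₁ 𝓘(ℝ, ℝ) ∞ ρ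
  ρ_pos : ∀ q, 0 < ρ q
  ver₁ : ∀ p, modelVertical I₁ L₁ φ₁ p ≠ ⊥
  ver₂ : ∀ p, modelVertical I₂ L₂ φ₂ p ≠ ⊥

/-- The fibres of `φ₁` satisfy `T_u v = -g₁(u, v) ∇ ln f`. -/
def HasLogUmbilicalFibres (L₁ : ModelWithCorners ℝ F₁ K₁) (g₁ : FormField I₁ M₁) (f : M₁ → ℝ)
    (φ₁ : M₁ → N₁) : Prop :=
  ∀ p, ∀ u ∈ modelVertical I₁ L₁ φ₁ p, ∀ v ∈ modelVertical I₁ L₁ φ₁ p,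
    ∀ x ∈ modelHorizontal L₁ g₁ φ₁ p, modelForm g₁ p (modelT L₁ g₁ φ₁ p u v) x
      = -(modelDeriv I₁ 𝓘(ℝ, ℝ) f p x / f p) * modelForm g₁ p u v

namespace WarpedSetup

variable {g₁ : FormField I₁ M₁} {f : M₁ → ℝ} {g₂ : FormField I₂ M₂}
  {h₁ : FormField L₁ N₁} {ρ : N₁ → ℝ} {h₂ : FormField L₂ N₂}
  {φ₁ : M₁ → N₁} {φ₂ : M₂ → N₂}

section Basic

variable (S : WarpedSetup g₁ f g₂ h₁ ρ h₂ φ₁ φ₂)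
include S

lemma mdiff₁ : MDifferentiable I₁ L₁ φ₁ := S.map.fst.smooth.mdifferentiable (by simp)

lemma mdiff₂ : MDifferentiable I₂ L₂ φ₂ := S.map.snd.smooth.mdifferentiable (by simp)

lemma isMetric : IsMetric (warped g₁ f g₂) := S.metric₁.warped S.smooth_f S.f_pos S.metric₂

lemma isMetric' : IsMetric (warped h₁ ρ h₂) := S.metric₁'.warped S.smooth_ρ S.ρ_pos S.metric₂'

lemma mem_ver {p : M₁ × M₂} {u : E₁ × E₂} :
    u ∈ modelVertical (I₁.prod I₂) (L₁.prod L₂) (Prod.map φ₁ φ₂) p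
      ↔ u.1 ∈ modelVertical I₁ L₁ φ₁ p.1 ∧ u.2 ∈ modelVertical I₂ L₂ φ₂ p.2 :=
  mem_modelVertical_prodMap (S.mdiff₁ _) (S.mdiff₂ _)

lemma mem_hor {p : M₁ × M₂} {x : E₁ × E₂} :
    x ∈ modelHorizontal (L₁.prod L₂) (warped g₁ f g₂) (Prod.map φ₁ φ₂) p
      ↔ x.1 ∈ modelHorizontal L₁ g₁ φ₁ p.1 ∧ x.2 ∈ modelHorizontal L₂ g₂ φ₂ p.2 :=
  mem_modelHorizontal_prodMap S.f_pos (S.mdiff₁ _) (S.mdiff₂ _)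

lemma modelDeriv_log_fst (p : M₁ × M₂) (w : E₁ × E₂) :
    modelDeriv (I₁.prod I₂) 𝓘(ℝ, ℝ) (fun x : M₁ × M₂ => Real.log (f x.1)) p w
      = modelDeriv I₁ 𝓘(ℝ, ℝ) f p.1 w.1 / f p.1 := by
  have h1 : MDifferentiableAt I₁ 𝓘(ℝ, ℝ) f p.1 := S.smooth_f.contMDiffAt.mdifferentiableAt (by simp)
  rw [modelDeriv_log (F := fun x : M₁ × M₂ => f x.1) (h1.comp p mdifferentiableAt_fst)
    (S.f_pos _).ne', modelDeriv_comp (F := (Prod.fst : M₁ × M₂ → M₁)) h1 mdifferentiableAt_fst,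
    modelDeriv_fst]
  rfl

lemma modelDeriv_ver [Nonempty M₂] {p : M₁} {u : E₁} (hu : u ∈ modelVertical I₁ L₁ φ₁ p) :
    modelDeriv I₁ 𝓘(ℝ, ℝ) f p u = 0 :=
  modelDeriv_eq_zero_of_comp (S.map.comp_eq S.metric₂ S.f_pos S.ρ_pos)
    (S.smooth_ρ.contMDiffAt.mdifferentiableAt (by simp)) (S.mdiff₁ p) hu

/-- The gradient of `ln f` is horizontal because `f = ρ ∘ φ₁`. -/
lemma gradient_log_fst_mem [Nonempty M₂] (p : M₁ × M₂) :
    modelGradient (warped g₁ f g₂) (fun x : M₁ × M₂ => Real.log (f x.1)) p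
      ∈ modelHorizontal (L₁.prod L₂) (warped g₁ f g₂) (Prod.map φ₁ φ₂) p := by
  refine mem_modelHorizontal.2 fun u hu => ?_
  rw [S.isMetric.modelForm_symm, S.isMetric.modelForm_modelGradient, S.modelDeriv_log_fst,
    S.modelDeriv_ver (S.mem_ver.1 hu).1, zero_div]

lemma forall_gradient_eq_iff (G : M₁ × M₂ → ℝ) :
    (∀ p, gradient (warped g₁ f g₂) G p
        = gradient (warped g₁ f g₂) (fun x : M₁ × M₂ => Real.log (f x.1)) p)
      ↔ ∀ (p : M₁ × M₂) (w : E₁ × E₂), modelDeriv (I₁.prod I₂) 𝓘(ℝ, ℝ) G p w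
        = modelDeriv I₁ 𝓘(ℝ, ℝ) f p.1 w.1 / f p.1 := by
  change (∀ p, modelGradient (warped g₁ f g₂) G p
    = modelGradient (warped g₁ f g₂) (fun x : M₁ × M₂ => Real.log (f x.1)) p) ↔ _
  refine forall_congr' fun p => ⟨fun h w => ?_, fun h => ?_⟩
  · rw [← S.modelDeriv_log_fst, ← S.isMetric.modelForm_modelGradient, h,
      S.isMetric.modelForm_modelGradient]
  · refine S.isMetric.eq_of_forall_modelForm_eq (p := p) (W := ⊤) Submodule.mem_top
      Submodule.mem_top fun w _ => ?_
    rw [S.isMetric.modelForm_modelGradient, S.isMetric.modelForm_modelGradient,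
      S.modelDeriv_log_fst, h]

/-- If the fibres of `φ₂` are totally geodesic and those of `φ₁` satisfy
`T_u v = -g₁(u, v) ∇ ln f`, then the fibres of `φ₁ × φ₂` satisfy `T_u v = -g(u, v) ∇ ln f`. -/
lemma modelForm_modelT_eq [Nonempty M₂] (hc : HasLogUmbilicalFibres L₁ g₁ f φ₁)
    (hb : HasTotallyGeodesicFibres L₂ g₂ φ₂) (p : M₁ × M₂) {u v x : E₁ × E₂}
    (hu : u ∈ modelVertical (I₁.prod I₂) (L₁.prod L₂) (Prod.map φ₁ φ₂) p)
    (hv : v ∈ modelVertical (I₁.prod I₂) (L₁.prod L₂) (Prod.map φ₁ φ₂) p)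
    (hx : x ∈ modelHorizontal (L₁.prod L₂) (warped g₁ f g₂) (Prod.map φ₁ φ₂) p) :
    modelForm (warped g₁ f g₂) p
        (modelT (L₁.prod L₂) (warped g₁ f g₂) (Prod.map φ₁ φ₂) p u v) x
      = -(modelDeriv I₁ 𝓘(ℝ, ℝ) f p.1 x.1 / f p.1) * modelForm (warped g₁ f g₂) p u v := by
  have hu' := S.mem_ver.1 hu
  have hv' := S.mem_ver.1 hv
  have hx' := S.mem_hor.1 hx
  have hf := (S.f_pos p.1).ne'
  have hb' : modelT L₂ g₂ φ₂ p.2 u.2 v.2 = 0 := hb p.2 _ hu'.2 _ hv'.2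
  rw [S.map.modelForm_modelT S.metric₁ S.metric₂ S.metric₁' S.metric₂' S.smooth_f S.f_pos
      S.smooth_ρ S.ρ_pos p hu'.1 hu'.2 hv'.1 hv'.2 hx'.1 hx'.2,
    hc p.1 _ hu'.1 _ hv'.1 _ hx'.1, hb', modelForm_warped]
  rw [map_zero, LinearMap.zero_apply]
  field_simp
  ring

/-- Inserting vectors of the factors into the pointwise Clairaut condition for `e^G` separates it
into conditions on `φ₁`, on `φ₂` and on `G`. -/
lemma clairautCondition_iff [Nonempty M₁] [Nonempty M₂] (G : M₁ × M₂ → ℝ) :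
    ClairautCondition (L₁.prod L₂) (warped g₁ f g₂) (Prod.map φ₁ φ₂) G ↔
      HasLogUmbilicalFibres L₁ g₁ f φ₁ ∧ HasTotallyGeodesicFibres L₂ g₂ φ₂ ∧
        ∀ (p : M₁ × M₂) (w : E₁ × E₂), modelDeriv (I₁.prod I₂) 𝓘(ℝ, ℝ) G p w
          = modelDeriv I₁ 𝓘(ℝ, ℝ) f p.1 w.1 / f p.1 := by
  constructor
  · intro h
    -- the condition splits into its values on vertical and on horizontal vectors
    have hver : ∀ (p : M₁ × M₂), ∀ u ∈ modelVertical (I₁.prod I₂) (L₁.prod L₂) (Prod.map φ₁ φ₂) p,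
        modelDeriv (I₁.prod I₂) 𝓘(ℝ, ℝ) G p u = 0 := by
      intro p u hu
      by_cases hu0 : u = 0
      · rw [hu0, map_zero]
      have h1 := h p u hu 0 (Submodule.zero_mem _)
      have h2 : 0 < modelForm (warped g₁ f g₂) p u u := S.isMetric.pos p u hu0
      rw [add_zero, map_zero, add_zero] at h1
      exact (mul_eq_zero.1 h1).resolve_right h2.ne'
    have hT : ∀ (p : M₁ × M₂) (u₁ : E₁) (u₂ : E₂) (x₁ : E₁) (x₂ : E₂),
        u₁ ∈ modelVertical I₁ L₁ φ₁ p.1 → u₂ ∈ modelVertical I₂ L₂ φ₂ p.2 →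
        x₁ ∈ modelHorizontal L₁ g₁ φ₁ p.1 → x₂ ∈ modelHorizontal L₂ g₂ φ₂ p.2 →
        modelDeriv (I₁.prod I₂) 𝓘(ℝ, ℝ) G p (x₁, x₂)
            * (modelForm g₁ p.1 u₁ u₁ + f p.1 ^ 2 * modelForm g₂ p.2 u₂ u₂)
          + (modelForm g₁ p.1 (modelT L₁ g₁ φ₁ p.1 u₁ u₁) x₁
            + f p.1 ^ 2 * modelForm g₂ p.2 (modelT L₂ g₂ φ₂ p.2 u₂ u₂) x₂
            - f p.1 * modelDeriv I₁ 𝓘(ℝ, ℝ) f p.1 x₁ * modelForm g₂ p.2 u₂ u₂) = 0 := by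
      intro p u₁ u₂ x₁ x₂ hu₁ hu₂ hx₁ hx₂
      have hu : ((u₁, u₂) : E₁ × E₂)
          ∈ modelVertical (I₁.prod I₂) (L₁.prod L₂) (Prod.map φ₁ φ₂) p := S.mem_ver.2 ⟨hu₁, hu₂⟩
      have hx : ((x₁, x₂) : E₁ × E₂)
          ∈ modelHorizontal (L₁.prod L₂) (warped g₁ f g₂) (Prod.map φ₁ φ₂) p :=
        S.mem_hor.2 ⟨hx₁, hx₂⟩
      have h1 := h p _ hu _ hx
      rw [S.map.modelForm_modelT S.metric₁ S.metric₂ S.metric₁' S.metric₂' S.smooth_f S.f_pos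
          S.smooth_ρ S.ρ_pos p hu₁ hu₂ hu₁ hu₂
        hx₁ hx₂, map_add, hver p _ hu, zero_add, modelForm_warped] at h1
      exact h1
    have hz₁ : ∀ (p : M₁) {x : E₁}, x ∈ modelHorizontal L₁ g₁ φ₁ p →
        modelForm g₁ p (modelT L₁ g₁ φ₁ p 0 0) x = 0 := fun p x hx =>
      S.map.fst.modelForm_modelT_zero S.metric₁ S.metric₁' p hx
    have hz₂ : ∀ (p : M₂) {x : E₂}, x ∈ modelHorizontal L₂ g₂ φ₂ p →
        modelForm g₂ p (modelT L₂ g₂ φ₂ p 0 0) x = 0 := fun p x hx =>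
      S.map.snd.modelForm_modelT_zero S.metric₂ S.metric₂' p hx
    -- vertical vectors of the second factor determine `dG` on horizontal ones of the first
    have hG₁ : ∀ (p : M₁ × M₂), ∀ x ∈ modelHorizontal L₁ g₁ φ₁ p.1,
        modelDeriv (I₁.prod I₂) 𝓘(ℝ, ℝ) G p (x, 0)
          = modelDeriv I₁ 𝓘(ℝ, ℝ) f p.1 x / f p.1 := by
      intro p x hx
      obtain ⟨u, hu, hu0⟩ := Submodule.exists_mem_ne_zero_of_ne_bot (S.ver₂ p.2)
      have hpos : 0 < modelForm g₂ p.2 u u := S.metric₂.pos _ _ hu0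
      have hf := S.f_pos p.1
      have h1 := hT p 0 u x 0 (Submodule.zero_mem _) hu hx (Submodule.zero_mem _)
      simp only [map_zero, zero_add, hz₁ p.1 hx] at h1
      have h2 : modelForm g₂ p.2 u u * f p.1
          * (modelDeriv (I₁.prod I₂) 𝓘(ℝ, ℝ) G p (x, 0) * f p.1
            - modelDeriv I₁ 𝓘(ℝ, ℝ) f p.1 x) = 0 := by
        linear_combination h1
      have h3 := (mul_eq_zero.1 h2).resolve_left (by positivity)
      rw [eq_div_iff hf.ne']
      linarith
    -- and vertical vectors of the first factor on horizontal ones of the second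
    have hG₂ : ∀ (p : M₁ × M₂), ∀ x ∈ modelHorizontal L₂ g₂ φ₂ p.2,
        modelDeriv (I₁.prod I₂) 𝓘(ℝ, ℝ) G p (0, x) = 0 := by
      intro p x hx
      obtain ⟨u, hu, hu0⟩ := Submodule.exists_mem_ne_zero_of_ne_bot (S.ver₁ p.1)
      have hpos : 0 < modelForm g₁ p.1 u u := S.metric₁.pos _ _ hu0
      have h1 := hT p u 0 0 x hu (Submodule.zero_mem _) (Submodule.zero_mem _) hx
      simp only [map_zero, mul_zero, add_zero, hz₂ p.2 hx, sub_zero] at h1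
      exact (mul_eq_zero.1 h1).resolve_right hpos.ne'
    refine ⟨fun p u hu v hv x hx => ?_, fun p u hu v hv => ?_, fun p w => ?_⟩
    · obtain ⟨q⟩ := ‹Nonempty M₂›
      refine S.map.fst.modelForm_modelT_of_diag S.metric₁ S.metric₁' p hx (fun u hu => ?_) hu hv
      have h1 := hT (p, q) u 0 x 0 hu (Submodule.zero_mem _) hx (Submodule.zero_mem _)
      rw [hG₁ (p, q) x hx] at h1
      simp only [map_zero, mul_zero, add_zero, sub_zero] at h1
      linarith
    · obtain ⟨q⟩ := ‹Nonempty M₁›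
      have hmem := modelT_mem (I' := L₂) (φ := φ₂) S.metric₂ p u v
      refine S.metric₂.eq_of_forall_modelForm_eq (p := p) (a := modelT L₂ g₂ φ₂ p u v)
        (b := (0 : E₂)) hmem
        (Submodule.zero_mem _) fun x hx => ?_
      rw [LinearMap.map_zero, LinearMap.zero_apply, ← zero_mul (modelForm g₂ p u v)]
      refine S.map.snd.modelForm_modelT_of_diag S.metric₂ S.metric₂' p hx (fun u hu => ?_) hu hv
      have hf := S.f_pos q
      have h1 := hT (q, p) 0 u 0 x (Submodule.zero_mem _) hu (Submodule.zero_mem _) hx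
      rw [hG₂ (q, p) x hx] at h1
      simp only [map_zero, mul_zero, zero_mul, zero_add, sub_zero] at h1 ⊢
      exact (mul_eq_zero.1 h1).resolve_left (by positivity)
    · set v₁ := modelVertProj L₁ g₁ φ₁ p.1 w.1
      set v₂ := modelVertProj L₂ g₂ φ₂ p.2 w.2
      have hv₁ : v₁ ∈ modelVertical I₁ L₁ φ₁ p.1 := modelVertProj_mem S.metric₁ _ _
      have hv₂ : v₂ ∈ modelVertical I₂ L₂ φ₂ p.2 := modelVertProj_mem S.metric₂ _ _
      have hw : w = (v₁, v₂) + ((w.1 - v₁, 0) + (0, w.2 - v₂)) := by ext <;> simp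
      conv_lhs => rw [hw]
      rw [map_add, map_add, hver p _ (S.mem_ver.2 ⟨hv₁, hv₂⟩),
        hG₁ p _ (sub_modelVertProj_mem S.metric₁ _ _),
        hG₂ p _ (sub_modelVertProj_mem S.metric₂ _ _),
        map_sub, S.modelDeriv_ver hv₁]
      simp
  · rintro ⟨hc, hb, ha⟩ p u hu x hx
    rw [S.modelForm_modelT_eq hc hb p hu hu hx, map_add, ha, ha,
      S.modelDeriv_ver (S.mem_ver.1 hu).1]
    ring

end Basic

end WarpedSetup

end WarpedClairaut

/-! ### The mean curvature of the fibres of a warped product map -/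

section Umbilic

variable {E : Type*} [NormedAddCommGroup E] [NormedSpace ℝ E] [FiniteDimensional ℝ E]
  {H : Type*} [TopologicalSpace H] {I : ModelWithCorners ℝ E H}
  {M : Type*} [TopologicalSpace M] [ChartedSpace H M]
  {E' : Type*} [NormedAddCommGroup E'] [NormedSpace ℝ E']
  {H' : Type*} [TopologicalSpace H'] {I' : ModelWithCorners ℝ E' H'}
  {N : Type*} [TopologicalSpace N] [ChartedSpace H' N]
  {g : FormField I M} {φ : M → N}

/-- The formula `T_u v = g(u, v) X` may be tested against horizontal vectors. -/
lemma IsMetric.oneillT_eq_smul (hg : IsMetric g) {X : M → E}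
    (hX : ∀ p, X p ∈ modelHorizontal I' g φ p)
    (h : ∀ p, ∀ u ∈ modelVertical I I' φ p, ∀ v ∈ modelVertical I I' φ p,
      ∀ x ∈ modelHorizontal I' g φ p,
        modelForm g p (modelT I' g φ p u v) x = modelForm g p (X p) x * modelForm g p u v) :
    ∀ p : M, ∀ u ∈ vertical I I' φ p, ∀ v ∈ vertical I I' φ p,
      oneillT I' g φ p u v = g p u v • (X p : TangentSpace I p) := by
  have key : ∀ p, ∀ u ∈ modelVertical I I' φ p, ∀ v ∈ modelVertical I I' φ p,
      modelT I' g φ p u v = modelForm g p u v • X p := by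
    intro p u hu v hv
    refine hg.eq_of_forall_modelForm_eq (p := p) (modelT_mem hg p u v)
      (Submodule.smul_mem _ _ (hX p))
      fun x hx => ?_
    rw [h p u hu v hv x hx, map_smul, LinearMap.smul_apply, smul_eq_mul, mul_comm]
  exact key

end Umbilic

section WarpedMeanCurvature

variable {E₁ : Type*} [NormedAddCommGroup E₁] [NormedSpace ℝ E₁] [FiniteDimensional ℝ E₁]
  {H₁ : Type*} [TopologicalSpace H₁] {I₁ : ModelWithCorners ℝ E₁ H₁} [I₁.Boundaryless]
  {M₁ : Type*} [TopologicalSpace M₁] [ChartedSpace H₁ M₁] [IsManifold I₁ ∞ M₁]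
  {E₂ : Type*} [NormedAddCommGroup E₂] [NormedSpace ℝ E₂] [FiniteDimensional ℝ E₂]
  {H₂ : Type*} [TopologicalSpace H₂] {I₂ : ModelWithCorners ℝ E₂ H₂} [I₂.Boundaryless]
  {M₂ : Type*} [TopologicalSpace M₂] [ChartedSpace H₂ M₂] [IsManifold I₂ ∞ M₂]
  {F₁ : Type*} [NormedAddCommGroup F₁] [NormedSpace ℝ F₁] [FiniteDimensional ℝ F₁]
  {K₁ : Type*} [TopologicalSpace K₁] {L₁ : ModelWithCorners ℝ F₁ K₁} [L₁.Boundaryless]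
  {N₁ : Type*} [TopologicalSpace N₁] [ChartedSpace K₁ N₁] [IsManifold L₁ ∞ N₁]
  {F₂ : Type*} [NormedAddCommGroup F₂] [NormedSpace ℝ F₂] [FiniteDimensional ℝ F₂]
  {K₂ : Type*} [TopologicalSpace K₂] {L₂ : ModelWithCorners ℝ F₂ K₂} [L₂.Boundaryless]
  {N₂ : Type*} [TopologicalSpace N₂] [ChartedSpace K₂ N₂] [IsManifold L₂ ∞ N₂]
  {g₁ : FormField I₁ M₁} {f : M₁ → ℝ} {g₂ : FormField I₂ M₂}
  {h₁ : FormField L₁ N₁} {ρ : N₁ → ℝ} {h₂ : FormField L₂ N₂}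
  {φ₁ : M₁ → N₁} {φ₂ : M₂ → N₂}

namespace WarpedSetup

variable (S : WarpedSetup g₁ f g₂ h₁ ρ h₂ φ₁ φ₂)
include S

/-- Orthonormal bases of the vertical spaces of the factors, the second one rescaled by `1 / f`,
form an orthonormal basis of the vertical space of the product. -/
lemma orthonormal_addCases (p : M₁ × M₂) {k₁ k₂ : ℕ} {e₁ : Fin k₁ → E₁} {e₂ : Fin k₂ → E₂}
    (he₁ : ∀ i j, modelForm g₁ p.1 (e₁ i) (e₁ j) = if i = j then 1 else 0)
    (he₂ : ∀ i j, modelForm g₂ p.2 (e₂ i) (e₂ j) = if i = j then 1 else 0)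
    (i j : Fin (k₁ + k₂)) :
    modelForm (warped g₁ f g₂) p
      (Fin.addCases (motive := fun _ => E₁ × E₂) (fun i => (e₁ i, 0))
        (fun j => (0, (f p.1)⁻¹ • e₂ j)) i)
      (Fin.addCases (motive := fun _ => E₁ × E₂) (fun i => (e₁ i, 0))
        (fun j => (0, (f p.1)⁻¹ • e₂ j)) j) = if i = j then 1 else 0 := by
  have hf := (S.f_pos p.1).ne'
  refine Fin.addCases (fun i => ?_) (fun i => ?_) i <;>
    refine Fin.addCases (fun j => ?_) (fun j => ?_) j <;>
    simp only [Fin.addCases_left, Fin.addCases_right, modelForm_warped]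
  · simp [he₁]
  · have : Fin.castAdd k₂ i ≠ Fin.natAdd k₁ j := fun h => by
      have := congrArg Fin.val h
      simp at this
      omega
    simp [this]
  · have : Fin.natAdd k₁ i ≠ Fin.castAdd k₂ j := fun h => by
      have := congrArg Fin.val h
      simp at this
      omega
    simp [this]
  · simp only [map_zero, map_smul, LinearMap.smul_apply, smul_eq_mul, he₂,
      zero_add, Fin.natAdd_inj]
    field_simp

lemma span_addCases (p : M₁ × M₂) {k₁ k₂ : ℕ} {e₁ : Fin k₁ → E₁} {e₂ : Fin k₂ → E₂}
    (he₁ : Submodule.span ℝ (range e₁) = modelVertical I₁ L₁ φ₁ p.1)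
    (he₂ : Submodule.span ℝ (range e₂) = modelVertical I₂ L₂ φ₂ p.2) :
    Submodule.span ℝ (range (Fin.addCases (motive := fun _ => E₁ × E₂) (fun i => (e₁ i, 0))
        (fun j => (0, (f p.1)⁻¹ • e₂ j))))
      = modelVertical (I₁.prod I₂) (L₁.prod L₂) (Prod.map φ₁ φ₂) p := by
  set e : Fin (k₁ + k₂) → E₁ × E₂ := Fin.addCases (motive := fun _ => E₁ × E₂)
    (fun i => (e₁ i, 0)) (fun j => (0, (f p.1)⁻¹ • e₂ j)) with he
  have hl : ∀ i, e (Fin.castAdd k₂ i) = (e₁ i, 0) := fun i => Fin.addCases_left i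
  have hr : ∀ j, e (Fin.natAdd k₁ j) = (0, (f p.1)⁻¹ • e₂ j) := fun j => Fin.addCases_right j
  apply le_antisymm
  · rw [Submodule.span_le]
    rintro _ ⟨i, rfl⟩
    refine Fin.addCases (fun i => ?_) (fun j => ?_) i
    · rw [hl]
      exact S.mem_ver.2 ⟨he₁ ▸ Submodule.subset_span (mem_range_self i), Submodule.zero_mem _⟩
    · rw [hr]
      exact S.mem_ver.2 ⟨Submodule.zero_mem _,
        Submodule.smul_mem _ _ (he₂ ▸ Submodule.subset_span (mem_range_self j))⟩
  · intro w hw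
    obtain ⟨hw₁, hw₂⟩ := S.mem_ver.1 hw
    have h1 : (Submodule.span ℝ (range e₁)).map (LinearMap.inl ℝ E₁ E₂)
        ≤ Submodule.span ℝ (range e) := by
      rw [Submodule.map_span, Submodule.span_le]
      rintro _ ⟨_, ⟨i, rfl⟩, rfl⟩
      exact Submodule.subset_span ⟨_, hl i⟩
    have h2 : (Submodule.span ℝ (range e₂)).map (LinearMap.inr ℝ E₁ E₂)
        ≤ Submodule.span ℝ (range e) := by
      rw [Submodule.map_span, Submodule.span_le]
      rintro _ ⟨_, ⟨j, rfl⟩, rfl⟩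
      have h3 : LinearMap.inr ℝ E₁ E₂ (e₂ j) = f p.1 • e (Fin.natAdd k₁ j) := by
        rw [hr, Prod.smul_mk, smul_inv_smul₀ (S.f_pos p.1).ne', smul_zero]
        rfl
      rw [h3]
      exact Submodule.smul_mem _ _ (Submodule.subset_span (mem_range_self _))
    rw [← he₁] at hw₁
    rw [← he₂] at hw₂
    have h3 := Submodule.add_mem _ (h1 (Submodule.mem_map_of_mem hw₁))
      (h2 (Submodule.mem_map_of_mem hw₂))
    simpa using h3

/-- The mean curvature of the fibres of `φ₁ × φ₂` is an average of that of the fibres of `φ₁` and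
of `-∇ ln f`. If it equals `-∇ ln f`, then so does the former. -/
lemma hasLogUmbilicalFibres [Nonempty M₂] (hu : HasTotallyUmbilicalFibres L₁ g₁ φ₁)
    (hH : IsMeanCurvatureField (L₁.prod L₂) (warped g₁ f g₂) (Prod.map φ₁ φ₂)
      (fun p => -gradient (warped g₁ f g₂) (fun x => Real.log (f x.1)) p)) :
    HasLogUmbilicalFibres L₁ g₁ f φ₁ := by
  obtain ⟨X, -, hX⟩ := hu
  have hX' : ∃ X : M₁ → E₁, ∀ p, ∀ u ∈ modelVertical I₁ L₁ φ₁ p,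
      ∀ v ∈ modelVertical I₁ L₁ φ₁ p, modelT L₁ g₁ φ₁ p u v = modelForm g₁ p u v • X p :=
    ⟨X, hX⟩
  clear hX X
  obtain ⟨X, hX⟩ := hX'
  have hH' : ∀ (p : M₁ × M₂) (k : ℕ) (e : Fin k → E₁ × E₂),
      (∀ i j, modelForm (warped g₁ f g₂) p (e i) (e j) = if i = j then 1 else 0) →
      Submodule.span ℝ (range e)
        = modelVertical (I₁.prod I₂) (L₁.prod L₂) (Prod.map φ₁ φ₂) p →
      -modelGradient (warped g₁ f g₂) (fun x : M₁ × M₂ => Real.log (f x.1)) p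
        = (k : ℝ)⁻¹ • ∑ i, modelT (L₁.prod L₂) (warped g₁ f g₂) (Prod.map φ₁ φ₂) p (e i) (e i) :=
    hH
  intro p₁ u hu v hv x hx
  obtain ⟨p₂⟩ := ‹Nonempty M₂›
  obtain ⟨k₁, e₁, he₁, hs₁⟩ := exists_orthonormal_span S.metric₁ p₁ (modelVertical I₁ L₁ φ₁ p₁)
  obtain ⟨k₂, e₂, he₂, hs₂⟩ := exists_orthonormal_span S.metric₂ p₂ (modelVertical I₂ L₂ φ₂ p₂)
  have hk₁ : k₁ ≠ 0 := by
    rintro rfl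
    refine S.ver₁ p₁ ?_
    rw [range_eq_empty, Submodule.span_empty] at hs₁
    exact hs₁.symm
  have hf := (S.f_pos p₁).ne'
  have h1 := hH' (p₁, p₂) (k₁ + k₂) _ (S.orthonormal_addCases (p₁, p₂) he₁ he₂)
    (S.span_addCases (p₁, p₂) hs₁ hs₂)
  have h2 := congrArg (fun a => modelForm (warped g₁ f g₂) (p₁, p₂) a (x, 0)) h1
  have hm₁ : ∀ i, e₁ i ∈ modelVertical I₁ L₁ φ₁ p₁ := fun i =>
    hs₁ ▸ Submodule.subset_span (mem_range_self i)
  have hm₂ : ∀ i, (f p₁)⁻¹ • e₂ i ∈ modelVertical I₂ L₂ φ₂ p₂ := fun i =>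
    Submodule.smul_mem _ _ (hs₂ ▸ Submodule.subset_span (mem_range_self i))
  have hl : ∀ i, modelForm (warped g₁ f g₂) (p₁, p₂) (modelT (L₁.prod L₂) (warped g₁ f g₂)
      (Prod.map φ₁ φ₂) (p₁, p₂) (e₁ i, 0) (e₁ i, 0)) (x, 0) = modelForm g₁ p₁ (X p₁) x := by
    intro i
    rw [S.map.modelForm_modelT S.metric₁ S.metric₂ S.metric₁' S.metric₂' S.smooth_f S.f_pos
      S.smooth_ρ S.ρ_pos (p₁, p₂) (hm₁ i) (Submodule.zero_mem _) (hm₁ i) (Submodule.zero_mem _)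
      hx (Submodule.zero_mem _)]
    simp only [hX p₁ _ (hm₁ i) _ (hm₁ i), he₁, if_true, one_smul, map_zero, mul_zero, add_zero,
      sub_zero]
  have hr : ∀ i, modelForm (warped g₁ f g₂) (p₁, p₂) (modelT (L₁.prod L₂) (warped g₁ f g₂)
      (Prod.map φ₁ φ₂) (p₁, p₂) (0, (f p₁)⁻¹ • e₂ i) (0, (f p₁)⁻¹ • e₂ i)) (x, 0)
        = -(modelDeriv I₁ 𝓘(ℝ, ℝ) f p₁ x / f p₁) := by
    intro i
    rw [S.map.modelForm_modelT S.metric₁ S.metric₂ S.metric₁' S.metric₂' S.smooth_f S.f_pos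
      S.smooth_ρ S.ρ_pos (p₁, p₂) (Submodule.zero_mem _) (hm₂ i) (Submodule.zero_mem _) (hm₂ i)
      hx (Submodule.zero_mem _)]
    simp only [S.map.fst.modelForm_modelT_zero S.metric₁ S.metric₁' p₁ hx, map_zero, mul_zero,
      zero_add, map_smul, LinearMap.smul_apply, smul_eq_mul, he₂, if_true]
    field_simp
    simp
  simp only [map_neg, LinearMap.neg_apply, S.isMetric.modelForm_modelGradient,
    S.modelDeriv_log_fst, map_smul, LinearMap.smul_apply, map_add,
    LinearMap.add_apply, map_sum, LinearMap.sum_apply, smul_eq_mul, Fin.sum_univ_add,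
    Fin.addCases_left, Fin.addCases_right, hl, hr,
    Finset.sum_const, Finset.card_univ, Fintype.card_fin, nsmul_eq_mul] at h2
  have hk : (k₁ : ℝ) ≠ 0 := Nat.cast_ne_zero.2 hk₁
  have hk' : ((k₁ + k₂ : ℕ) : ℝ) ≠ 0 := Nat.cast_ne_zero.2 (by omega)
  have h3 : (k₁ : ℝ) * (modelForm g₁ p₁ (X p₁) x + modelDeriv I₁ 𝓘(ℝ, ℝ) f p₁ x / f p₁) = 0 := by
    rw [eq_inv_mul_iff_mul_eq₀ hk'] at h2
    push_cast at h2
    linear_combination -h2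
  have h4 := (mul_eq_zero.1 h3).resolve_left hk
  rw [hX p₁ u hu v hv, map_smul, LinearMap.smul_apply, smul_eq_mul]
  linear_combination modelForm g₁ p₁ u v * h4

lemma hasTotallyUmbilicalFibres [Nonempty M₂] (hc : HasLogUmbilicalFibres L₁ g₁ f φ₁) :
    HasTotallyUmbilicalFibres L₁ g₁ φ₁ := by
  have hlog : ∀ (p : M₁) (x : E₁), modelDeriv I₁ 𝓘(ℝ, ℝ) (fun q => Real.log (f q)) p x
      = modelDeriv I₁ 𝓘(ℝ, ℝ) f p x / f p := fun p x =>
    modelDeriv_log (S.smooth_f.contMDiffAt.mdifferentiableAt (by simp)) (S.f_pos p).ne' x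
  have h := S.metric₁.oneillT_eq_smul (I' := L₁) (φ := φ₁)
    (X := fun p => -modelGradient g₁ (fun q => Real.log (f q)) p)
    (fun p => Submodule.neg_mem _ (mem_modelHorizontal.2 fun u hu => by
      rw [S.metric₁.modelForm_symm, S.metric₁.modelForm_modelGradient, hlog,
        S.modelDeriv_ver hu, zero_div]))
    (fun p u hu v hv x hx => by
      rw [hc p u hu v hv x hx, map_neg, LinearMap.neg_apply,
        S.metric₁.modelForm_modelGradient, hlog])
  exact ⟨_, isMeanCurvatureField_of_umbilic S.ver₁ h, h⟩

lemma isMeanCurvatureField [Nonempty M₂] (hc : HasLogUmbilicalFibres L₁ g₁ f φ₁)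
    (hb : HasTotallyGeodesicFibres L₂ g₂ φ₂) :
    IsMeanCurvatureField (L₁.prod L₂) (warped g₁ f g₂) (Prod.map φ₁ φ₂)
      (fun p => -gradient (warped g₁ f g₂) (fun x => Real.log (f x.1)) p) := by
  have h := S.isMetric.oneillT_eq_smul (I' := L₁.prod L₂) (φ := Prod.map φ₁ φ₂)
    (X := fun p => -modelGradient (warped g₁ f g₂) (fun x : M₁ × M₂ => Real.log (f x.1)) p)
    (fun p => Submodule.neg_mem _ (S.gradient_log_fst_mem p))
    (fun p u hu v hv x hx => by
      rw [S.modelForm_modelT_eq hc hb p hu hv hx, map_neg, LinearMap.neg_apply,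
        S.isMetric.modelForm_modelGradient, S.modelDeriv_log_fst])
  refine isMeanCurvatureField_of_umbilic (fun p hp => S.ver₁ p.1 ?_) h
  rw [Submodule.eq_bot_iff]
  intro u hu
  have h1 : ((u, 0) : E₁ × E₂)
      ∈ modelVertical (I₁.prod I₂) (L₁.prod L₂) (Prod.map φ₁ φ₂) p :=
    S.mem_ver.2 ⟨hu, Submodule.zero_mem _⟩
  rw [hp, Submodule.mem_bot] at h1
  exact congrArg Prod.fst h1

lemma isClairaut_iff [Nonempty M₁] [Nonempty M₂] {G : M₁ × M₂ → ℝ}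
    (hG : ContMDiff (I₁.prod I₂) 𝓘(ℝ, ℝ) ∞ G) :
    IsClairaut (warped g₁ f g₂) (warped h₁ ρ h₂) (Prod.map φ₁ φ₂) (fun p => Real.exp (G p)) ↔
      (HasTotallyUmbilicalFibres L₁ g₁ φ₁ ∧ HasTotallyGeodesicFibres L₂ g₂ φ₂ ∧
        IsMeanCurvatureField (L₁.prod L₂) (warped g₁ f g₂) (Prod.map φ₁ φ₂)
          (fun p => -gradient (warped g₁ f g₂) (fun x => Real.log (f x.1)) p) ∧
        ∀ p, gradient (warped g₁ f g₂) G p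
          = gradient (warped g₁ f g₂) (fun x => Real.log (f x.1)) p) := by
  rw [ClairautWarped.isClairaut_iff S.map.prod S.isMetric S.isMetric' hG, S.clairautCondition_iff,
    S.forall_gradient_eq_iff]
  exact ⟨fun ⟨hc, hb, hg⟩ =>
      ⟨S.hasTotallyUmbilicalFibres hc, hb, S.isMeanCurvatureField hc hb, hg⟩,
    fun ⟨hu, hb, hH, hg⟩ => ⟨S.hasLogUmbilicalFibres hu hH, hb, hg⟩⟩

lemma contMDiff_log_fst :
    ContMDiff (I₁.prod I₂) 𝓘(ℝ, ℝ) ∞ (fun p : M₁ × M₂ => Real.log (f p.1)) := fun p =>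
  ContMDiffAt.comp (g := Real.log) (f := fun p : M₁ × M₂ => f p.1) p
    (Real.contDiffAt_log.2 (S.f_pos p.1).ne').contMDiffAt
    ((S.smooth_f.comp contMDiff_fst).contMDiffAt)

end WarpedSetup

end WarpedMeanCurvature

end ClairautWarped

end

theorem mainTheorem1
    {E₁ : Type*} [NormedAddCommGroup E₁] [NormedSpace ℝ E₁] [FiniteDimensional ℝ E₁]
    {M₁ : Type*} [TopologicalSpace M₁] [ChartedSpace E₁ M₁] [IsManifold 𝓘(ℝ, E₁) ∞ M₁]
    [Nonempty M₁]
    {E₂ : Type*} [NormedAddCommGroup E₂] [NormedSpace ℝ E₂] [FiniteDimensional ℝ E₂]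
    {M₂ : Type*} [TopologicalSpace M₂] [ChartedSpace E₂ M₂] [IsManifold 𝓘(ℝ, E₂) ∞ M₂]
    [Nonempty M₂]
    {F₁ : Type*} [NormedAddCommGroup F₁] [NormedSpace ℝ F₁] [FiniteDimensional ℝ F₁]
    {N₁ : Type*} [TopologicalSpace N₁] [ChartedSpace F₁ N₁] [IsManifold 𝓘(ℝ, F₁) ∞ N₁]
    {F₂ : Type*} [NormedAddCommGroup F₂] [NormedSpace ℝ F₂] [FiniteDimensional ℝ F₂]
    {N₂ : Type*} [TopologicalSpace N₂] [ChartedSpace F₂ N₂] [IsManifold 𝓘(ℝ, F₂) ∞ N₂]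
    (g₁ : RiemMetric 𝓘(ℝ, E₁) M₁) (g₂ : RiemMetric 𝓘(ℝ, E₂) M₂)
    (h₁ : RiemMetric 𝓘(ℝ, F₁) N₁) (h₂ : RiemMetric 𝓘(ℝ, F₂) N₂)
    (f : M₁ → ℝ) (hf : ContMDiff 𝓘(ℝ, E₁) 𝓘(ℝ, ℝ) ∞ f) (hf0 : ∀ p, 0 < f p)
    (ρ : N₁ → ℝ) (hρ : ContMDiff 𝓘(ℝ, F₁) 𝓘(ℝ, ℝ) ∞ ρ) (hρ0 : ∀ q, 0 < ρ q)
    (φ₁ : M₁ → N₁) (φ₂ : M₂ → N₂)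
    (hφ : IsRiemannianWarpedProductMap g₁.form f g₂.form h₁.form ρ h₂.form φ₁ φ₂)
    -- the fibres of both factors have positive dimension
    (hV₁ : ∀ p, vertical 𝓘(ℝ, E₁) 𝓘(ℝ, F₁) φ₁ p ≠ ⊥)
    (hV₂ : ∀ p, vertical 𝓘(ℝ, E₂) 𝓘(ℝ, F₂) φ₂ p ≠ ⊥) :
    ((∃ g : M₁ × M₂ → ℝ, ContMDiff (𝓘(ℝ, E₁).prod 𝓘(ℝ, E₂)) 𝓘(ℝ, ℝ) ∞ g ∧
        IsClairaut (warped g₁.form f g₂.form) (warped h₁.form ρ h₂.form) (Prod.map φ₁ φ₂)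
          (fun p => Real.exp (g p))) ↔
      (HasTotallyUmbilicalFibres 𝓘(ℝ, F₁) g₁.form φ₁ ∧
        HasTotallyGeodesicFibres 𝓘(ℝ, F₂) g₂.form φ₂ ∧
        IsMeanCurvatureField (𝓘(ℝ, F₁).prod 𝓘(ℝ, F₂)) (warped g₁.form f g₂.form)
          (Prod.map φ₁ φ₂)
          (fun p => -gradient (warped g₁.form f g₂.form) (fun x => Real.log (f x.1)) p))) ∧
    (∀ g : M₁ × M₂ → ℝ, ContMDiff (𝓘(ℝ, E₁).prod 𝓘(ℝ, E₂)) 𝓘(ℝ, ℝ) ∞ g →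
      (IsClairaut (warped g₁.form f g₂.form) (warped h₁.form ρ h₂.form) (Prod.map φ₁ φ₂)
          (fun p => Real.exp (g p)) ↔
        (HasTotallyUmbilicalFibres 𝓘(ℝ, F₁) g₁.form φ₁ ∧
          HasTotallyGeodesicFibres 𝓘(ℝ, F₂) g₂.form φ₂ ∧
          IsMeanCurvatureField (𝓘(ℝ, F₁).prod 𝓘(ℝ, F₂)) (warped g₁.form f g₂.form)
            (Prod.map φ₁ φ₂)
            (fun p => -gradient (warped g₁.form f g₂.form) (fun x => Real.log (f x.1)) p) ∧
          ∀ p, gradient (warped g₁.form f g₂.form) g p =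
            gradient (warped g₁.form f g₂.form) (fun x => Real.log (f x.1)) p))) := by
  have S : WarpedSetup g₁.form f g₂.form h₁.form ρ h₂.form φ₁ φ₂ :=
    ⟨hφ, g₁.isMetric, g₂.isMetric, h₁.isMetric, h₂.isMetric, hf, hf0, hρ, hρ0, hV₁, hV₂⟩
  refine ⟨⟨fun ⟨g, hg, hc⟩ => ?_, fun ⟨hu, hb, hH⟩ => ?_⟩, fun g hg => S.isClairaut_iff hg⟩
  · obtain ⟨hu, hb, hH, -⟩ := (S.isClairaut_iff hg).1 hc
    exact ⟨hu, hb, hH⟩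
  · exact ⟨fun p => Real.log (f p.1), S.contMDiff_log_fst,
      (S.isClairaut_iff S.contMDiff_log_fst).2 ⟨hu, hb, hH, fun _ => rfl⟩⟩
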